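/- Notation. $\|\cdot\|$ is the Euclidean norm of a vector or the spectral norm of a matrix, $A^\dagger$ is the Moore–Penrose inverse, $\mathcal K_t(A,b)=\mathrm{span}\{b,Ab,\dots,A^{t-1}b\}$, and $g=\nabla f$, $H=\nabla^2 f$. **Assumptions on $f$.** Let $f:\mathbb R^d\to\mathbb R$ be twice differentiable (second partial derivatives need not be assumed continuous), and suppose that * $\|H(x)-H(y)\|\le L_H\|x-y\|$ for all $x,y$, where $0\le L_H<\infty$; * for some $\gamma>0$, $\|H(x)p\|\ge\gamma\|p\|$ for all $x$ and all $p\in\mathrm{Range}(H(x))$; * for some $0<\nu\le 1$ and all $x$, $\|U_\perp^{\top}g(x)\|^2\le\frac{1-\nu}{\nu}\|U^{\top}g(x)\|^2$, where $U$ and $U_\perp$ are orthonormal bases of $\mathrm{Range}(H(x))$ and of its orthogonal complement. **Algorithm.** Let $0<\tau<1$, $\varepsilon>0$, $C\ge 1$ and $\theta<1$. Starting from any $x_0$, as long as $\|g(x_k)\|>\tau$, let $x_{k+1}=x_k+p_k$ (step size $\alpha_k=1$). Write $g_k=g(x_k)$. The approximate Hessian is $\tilde H_k=H(x_k)+E_k$,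 where $E_k$ is symmetric, $\|E_k\|\le\varepsilon$ and $\|\tilde H_k^\dagger\|\le C/\varepsilon$. The inexact direction $p_k$ satisfies $$p_k\in\mathrm{Range}(\tilde H_k),\qquad \langle p_k,\tilde H_kg_k\rangle\le-(1-\theta)\|g_k\|^2,$$ and is an iterate of MINRES-QLP: for some $1\le t\le\mathrm{rank}(\tilde H_k)$ it is the vector of least norm in $\mathrm{Argmin}_{p\in\mathcal K_t}\|\tilde H_kp+g_k\|$. Here either $\mathcal K_t=\mathcal K_t(\tilde H_k,\tilde H_kg_k)$, or $\mathcal K_t=\mathcal K_t(\tilde H_k,g_k)$, the latter being allowed only if $g_k\in\mathrm{Range}(\tilde H_k)$. **Conclusion.** For every $k$ at which the algorithm has not yet stopped, $$\|g(x_{k+1})\|\le\frac{L_H}{2\tilde\gamma^2}\|g(x_k)\|^2+\Big(\frac{\varepsilon}{\tilde\gamma}+\sqrt\theta\Big)\|g(x_k)\|$$ holds in each of the following two cases: 1. (general perturbation) either $\nu>\tfrac12$ and $\varepsilon<\gamma(2\nu-1)/4$, or $\nu=1$ and $\varepsilon<\gamma\nu/2$; moreover $1-\tilde\nu\le\theta<1$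 with $\tilde\nu=2\nu-1-\frac{4\varepsilon}{\gamma}$. In this case $$\tilde\gamma=\Big(\frac1{\gamma-\varepsilon}+C\Big(\frac2\gamma+\frac{\sqrt{1-\nu}}{\varepsilon}\Big)\Big)^{-1}.$$ 2. (acute perturbation) $\mathrm{rank}(\tilde H_k)=\mathrm{rank}(H(x_k))$ and $\varepsilon<\gamma\nu/2$; moreover $1-\tilde\nu\le\theta<1$ with $\tilde\nu=\nu-\frac{2\varepsilon}{\gamma}$. In this case $\tilde\gamma=\gamma-\varepsilon$. -/

import Mathlib

open scoped InnerProductSpace Gradient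

namespace NewtonMR

section LinearAlgebra

variable {E : Type*} [NormedAddCommGroup E] [InnerProductSpace ℝ E] [FiniteDimensional ℝ E]

/-- The Moore-Penrose generalized inverse of `A`: project orthogonally onto `range A`, then invert
the bijection `(ker A)ᗮ → range A` induced by `A`. The four Penrose equations are proved below. -/
noncomputable def pinv (A : E →L[ℝ] E) : E →L[ℝ] E :=
  LinearMap.toContinuousLinearMap
    ((LinearMap.ker A.toLinearMap)ᗮ.subtype ∘ₗ
      (LinearMap.kerComplementEquivRange A.toLinearMap
        (LinearMap.ker A.toLinearMap).isCompl_orthogonal.symm).symm.toLinearMap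
      ∘ₗ (LinearMap.range A.toLinearMap).orthogonalProjectionOnto.toLinearMap)

/-- For `y` in `range A`, `pinv A y` is the preimage of `y` in `(ker A)ᗮ`; in general
`A (pinv A y)` is the orthogonal projection of `y` onto `range A`. -/
theorem apply_pinv (A : E →L[ℝ] E) (y : E) :
    A (pinv A y) = (LinearMap.range A.toLinearMap).starProjection y := by
  have h := LinearEquiv.apply_symm_apply (LinearMap.kerComplementEquivRange A.toLinearMap
    (LinearMap.ker A.toLinearMap).isCompl_orthogonal.symm)
    ((LinearMap.range A.toLinearMap).orthogonalProjectionOnto y)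
  exact congrArg Subtype.val h

theorem pinv_mem (A : E →L[ℝ] E) (y : E) : pinv A y ∈ (LinearMap.ker A.toLinearMap)ᗮ :=
  Subtype.property _

theorem pinv_apply (A : E →L[ℝ] E) (z : E) :
    pinv A (A z) = (LinearMap.ker A.toLinearMap)ᗮ.starProjection z := by
  symm
  apply Submodule.eq_starProjection_of_mem_of_inner_eq_zero (pinv_mem A _)
  intro w hw
  have hk : z - pinv A (A z) ∈ LinearMap.ker A.toLinearMap := by
    have h1 : A (pinv A (A z)) = A z := by
      rw [apply_pinv]
      exact Submodule.starProjection_eq_self_iff.mpr ⟨z, rfl⟩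
    simp [LinearMap.mem_ker, map_sub, h1]
  exact (Submodule.mem_orthogonal _ _).mp hw _ hk

/-- The four Penrose equations. -/
theorem pinv_penrose (A : E →L[ℝ] E) :
    A ∘L pinv A ∘L A = A ∧ pinv A ∘L A ∘L pinv A = pinv A ∧
      IsSelfAdjoint (A ∘L pinv A) ∧ IsSelfAdjoint (pinv A ∘L A) := by
  have h1 : A ∘L pinv A = (LinearMap.range A.toLinearMap).starProjection :=
    ContinuousLinearMap.ext fun y => apply_pinv A y
  have h2 : pinv A ∘L A = (LinearMap.ker A.toLinearMap)ᗮ.starProjection :=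
    ContinuousLinearMap.ext fun y => pinv_apply A y
  refine ⟨?_, ?_, ?_, ?_⟩
  · ext z
    change A (pinv A (A z)) = A z
    rw [apply_pinv]
    exact Submodule.starProjection_eq_self_iff.mpr ⟨z, rfl⟩
  · ext y
    change pinv A (A (pinv A y)) = pinv A y
    rw [pinv_apply]
    exact Submodule.starProjection_eq_self_iff.mpr (pinv_mem A y)
  · rw [h1]
    exact isSelfAdjoint_starProjection _
  · rw [h2]
    exact isSelfAdjoint_starProjection _

/-- The rank of `A`. -/
noncomputable def rk (A : E →L[ℝ] E) : ℕ :=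
  Module.finrank ℝ (LinearMap.range A.toLinearMap)

/-- The Krylov subspace `K_t(A, b) = span {b, A b, …, A^(t-1) b}`. -/
def krylov (A : E →L[ℝ] E) (b : E) (t : ℕ) : Submodule ℝ E :=
  Submodule.span ℝ {v : E | ∃ i : ℕ, i < t ∧ v = (A ^ i) b}

/-- `K` is the `t`-th range-invariant Krylov subspace for `A` and `b`: it is `K_t(A, b)`, allowed
only if `b ∈ range A`, or `K_t(A, A b)`, which is always allowed; here `1 ≤ t ≤ rank A`. -/
def IsRangeInvariantKrylov (A : E →L[ℝ] E) (b : E) (t : ℕ) (K : Submodule ℝ E) : Prop :=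
  1 ≤ t ∧ t ≤ rk A ∧
    ((b ∈ LinearMap.range A.toLinearMap ∧ K = krylov A b t) ∨ K = krylov A (A b) t)

/-- `p` minimizes `‖A q + g‖` over `q ∈ K`. -/
def IsLeastSquaresOn (A : E →L[ℝ] E) (g : E) (K : Submodule ℝ E) (p : E) : Prop :=
  p ∈ K ∧ ∀ q ∈ K, ‖A p + g‖ ≤ ‖A q + g‖

/-- `p` is the `t`-th iterate of MINRES-QLP for `min ‖A p + g‖`: a least-norm element among the
minimizers of the residual norm over a `t`-th range-invariant Krylov subspace. -/
def IsMinresQLPIterate (A : E →L[ℝ] E) (g : E) (t : ℕ) (p : E) : Prop :=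
  ∃ K : Submodule ℝ E, IsRangeInvariantKrylov A g t K ∧ IsLeastSquaresOn A g K p ∧
    ∀ q, IsLeastSquaresOn A g K q → ‖p‖ ≤ ‖q‖

/-- `p` is an inexact update direction with tolerance `θ`, computed with MINRES-QLP:
`p ∈ range A`, `⟪p, A g⟫ ≤ -(1 - θ) ‖g‖²`, and `p` is some MINRES-QLP iterate. -/
def IsInexactDirection (A : E →L[ℝ] E) (g : E) (θ : ℝ) (p : E) : Prop :=
  p ∈ LinearMap.range A.toLinearMap ∧ ⟪p, A g⟫_ℝ ≤ -(1 - θ) * ‖g‖ ^ 2 ∧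
    ∃ t : ℕ, IsMinresQLPIterate A g t p

end LinearAlgebra

section Objective

variable {d : ℕ}

/-- The Hessian of `f`, the derivative of its gradient. -/
noncomputable def hess (f : EuclideanSpace ℝ (Fin d) → ℝ) (x : EuclideanSpace ℝ (Fin d)) :
    EuclideanSpace ℝ (Fin d) →L[ℝ] EuclideanSpace ℝ (Fin d) :=
  fderiv ℝ (∇ f) x

/-- `f` is twice differentiable; second partial derivatives may be discontinuous. -/
def TwiceDifferentiable (f : EuclideanSpace ℝ (Fin d) → ℝ) : Prop :=
  Differentiable ℝ f ∧ Differentiable ℝ (∇ f)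

/-- Lipschitz continuity of the Hessian in the spectral norm. -/
def HessianLipschitz (f : EuclideanSpace ℝ (Fin d) → ℝ) (L : ℝ) : Prop :=
  0 ≤ L ∧ ∀ x y, ‖hess f x - hess f y‖ ≤ L * ‖x - y‖

/-- Pseudo-inverse regularity with constant `γ`. -/
def PseudoInverseRegular (f : EuclideanSpace ℝ (Fin d) → ℝ) (γ : ℝ) : Prop :=
  0 < γ ∧ ∀ x, ∀ p ∈ LinearMap.range (hess f x).toLinearMap, γ * ‖p‖ ≤ ‖hess f x p‖

/-- Gradient-Hessian null-space property with constant `ν`. For orthonormal bases `U`, `U⊥` of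
`range (hess f x)` and of its orthogonal complement, `‖Uᵀ g‖` and `‖U⊥ᵀ g‖` are the norms of the
orthogonal projections of `g` onto these subspaces. -/
def NullSpaceProperty (f : EuclideanSpace ℝ (Fin d) → ℝ) (ν : ℝ) : Prop :=
  0 < ν ∧ ν ≤ 1 ∧ ∀ x,
    ‖(LinearMap.range (hess f x).toLinearMap)ᗮ.starProjection (∇ f x)‖ ^ 2 ≤
      (1 - ν) / ν * ‖(LinearMap.range (hess f x).toLinearMap).starProjection (∇ f x)‖ ^ 2

/-- `Ht = hess f x + E` with `E` symmetric, `‖E‖ ≤ ε`, and `‖Ht†‖ ≤ C / ε`. -/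
def IsPerturbation (f : EuclideanSpace ℝ (Fin d) → ℝ) (ε C : ℝ) (x : EuclideanSpace ℝ (Fin d))
    (Ht : EuclideanSpace ℝ (Fin d) →L[ℝ] EuclideanSpace ℝ (Fin d)) : Prop :=
  (∃ E : EuclideanSpace ℝ (Fin d) →L[ℝ] EuclideanSpace ℝ (Fin d),
    IsSelfAdjoint E ∧ Ht = hess f x + E ∧ ‖E‖ ≤ ε) ∧ ‖pinv Ht‖ ≤ C / ε

/-- The perturbation preserves the rank. -/
def IsAcute (f : EuclideanSpace ℝ (Fin d) → ℝ) (x : EuclideanSpace ℝ (Fin d))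
    (Ht : EuclideanSpace ℝ (Fin d) →L[ℝ] EuclideanSpace ℝ (Fin d)) : Prop :=
  rk Ht = rk (hess f x)

/-- The algorithm, started at `x 0`, has not stopped before or at iteration `k`. -/
def Active (f : EuclideanSpace ℝ (Fin d) → ℝ) (τ : ℝ) (x : ℕ → EuclideanSpace ℝ (Fin d))
    (k : ℕ) : Prop :=
  ∀ j ≤ k, τ < ‖∇ f (x j)‖

/-- `x` is a sequence of iterates of Newton-MR with approximate Hessians `Ht k`, inexact MINRES-QLP
update directions of tolerance `θ`, unit step sizes, and stopping rule `‖∇ f (x k)‖ ≤ τ`. Nothing is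
required of `x` after the algorithm has stopped. -/
def IsInexactNewtonMR (f : EuclideanSpace ℝ (Fin d) → ℝ) (τ θ : ℝ)
    (Ht : ℕ → EuclideanSpace ℝ (Fin d) →L[ℝ] EuclideanSpace ℝ (Fin d))
    (x : ℕ → EuclideanSpace ℝ (Fin d)) : Prop :=
  ∀ k, Active f τ x k →
    ∃ p, IsInexactDirection (Ht k) (∇ f (x k)) θ p ∧ x (k + 1) = x k + p

end Objective

/-- `ν̃` for a general perturbation. -/
noncomputable def nuTilde (γ ν ε : ℝ) : ℝ := 2 * ν - 1 - 4 * ε / γ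

/-- `ν̃` for an acute perturbation. -/
noncomputable def nuTildeAcute (γ ν ε : ℝ) : ℝ := ν - 2 * ε / γ

/-- `γ̃` for a general perturbation. -/
noncomputable def gammaTilde (γ ν ε C : ℝ) : ℝ :=
  (1 / (γ - ε) + C * (2 / γ + √(1 - ν) / ε))⁻¹

/-- `γ̃` for an acute perturbation. -/
noncomputable def gammaTildeAcute (γ ε : ℝ) : ℝ := γ - ε

end NewtonMR

open NewtonMR

/-! Taylor's formula gives ‖g(x+p)‖ ≤ (L/2)‖p‖² + ‖Ap+g‖ + ε‖p‖ with A the perturbed Hessian, and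
the normal equations with the descent condition give ‖Ap+g‖ ≤ √θ‖g‖. Everything rests on a bound for
‖p‖. By a dimension count the eigenvalues of A have modulus ≤ ε or ≥ γ−ε; the large ones contribute
at most ‖Ap‖/(γ−ε) ≤ ‖g‖/(γ−ε). Equal ranks leave no nonzero small eigenvalue, which settles the
acute case (`IsInexactDirection.norm_le_of_rk_eq`).

In the general case let Q project onto the small eigenspaces. Since ‖Qp‖ ≤ (C/ε)‖QAp‖, one needs
‖QAp‖ ≤ (2ε/γ)‖g‖ (`IsInexactDirection.norm_le`). Two facts give this.

First, g lies in the range of H. The kernel of H is constant (`kernel_eq`), hence so is the kernel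
component of g. Were it nonzero, the null-space property would keep the range component away from 0,
while damped Newton steps shrink it by a fixed factor (`grad_mem_range`). So ‖Qg‖ is of order
(ε/γ)‖g‖ (`norm_partialSum_le`).

Second, Ap = (r(A) − 1)g for a minimal residual polynomial r, and r − 1 is controlled in the mean on
the small eigenvalues (`sum_small_nodes_le`). To see this, r is compared with a residual polynomial
that stays in [0, 2] on [−ε, ε] and is either minimal or small on the large eigenvalues. It is found
by raising the degree of the minimal polynomial of the large nodes and, when the next one leaves the
safe region, interpolating between the two (`exists_bounded_residual`). Interpolants are real-rooted
with almost no roots in the gap, and an orthogonality relation turns a large slope at 0, or a root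
at ±ε, into decay on the large nodes (`sum_sq_le_of_decay`). -/

namespace NewtonMR

open Polynomial

/-! ### Residual polynomials and discrete orthogonality. -/

section ResidualPolynomials

variable {ι : Type*}

/-- Differences of residual polynomials: multiples of `X ^ j` of degree less than `n + j`. -/
def residualDirections (j n : ℕ) : Submodule ℝ ℝ[X] where
  carrier := {v | v.degree < ((n + j : ℕ) : WithBot ℕ) ∧ X ^ j ∣ v}
  add_mem' ha hb := ⟨(degree_add_le _ _).trans_lt (max_lt ha.1 hb.1), dvd_add ha.2 hb.2⟩
  zero_mem' := ⟨by rw [degree_zero]; exact WithBot.bot_lt_coe _, dvd_zero _⟩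
  smul_mem' c v hv := ⟨(degree_smul_le _ _).trans_lt hv.1, by
    rw [smul_eq_C_mul]; exact dvd_mul_of_dvd_right hv.2 _⟩

theorem residualDirections_mono (j n : ℕ) : residualDirections j n ≤ residualDirections j (n + 1) :=
  fun _ hv => ⟨hv.1.trans_le (by exact_mod_cast (by omega : n + j ≤ n + 1 + j)), hv.2⟩

/-- Residual polynomials: `1` plus a multiple of `X ^ j`, of degree less than `n + j`. -/
def IsResidual (j n : ℕ) (P : ℝ[X]) : Prop := P - 1 ∈ residualDirections j n

theorem IsResidual.mono {j n : ℕ} {P : ℝ[X]} (h : IsResidual j n P) : IsResidual j (n + 1) P :=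
  residualDirections_mono j n h

theorem IsResidual.sub_mem {j n : ℕ} {P Q : ℝ[X]} (hP : IsResidual j n P) (hQ : IsResidual j n Q) :
    P - Q ∈ residualDirections j n := by
  have h := (residualDirections j n).sub_mem hP hQ
  rwa [sub_sub_sub_cancel_right] at h

theorem IsResidual.convex {j n : ℕ} {P Q : ℝ[X]} (hP : IsResidual j n P) (hQ : IsResidual j n Q)
    (b : ℝ) : IsResidual j n ((1 - b) • P + b • Q) := by
  have h := (residualDirections j n).add_mem ((residualDirections j n).smul_mem (1 - b) hP)
    ((residualDirections j n).smul_mem b hQ)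
  have e : (1 - b) • P + b • Q - 1 = (1 - b) • (P - 1) + b • (Q - 1) := by
    simp only [smul_sub, sub_smul, one_smul]; abel
  rw [IsResidual, e]; exact h

theorem isResidual_one (j n : ℕ) : IsResidual j n 1 := by
  rw [IsResidual, sub_self]; exact Submodule.zero_mem _

theorem IsResidual.degree_lt {j n : ℕ} (hj : 1 ≤ j) {P : ℝ[X]} (h : IsResidual j n P) :
    P.degree < ((n + j : ℕ) : WithBot ℕ) := by
  have e : P = (P - 1) + 1 := by ring
  rw [e]
  refine (degree_add_le _ _).trans_lt (max_lt h.1 ?_)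
  rw [degree_one]
  exact_mod_cast (by omega : 0 < n + j)

theorem IsResidual.coeff_zero {j n : ℕ} (hj : 1 ≤ j) {P : ℝ[X]} (h : IsResidual j n P) :
    P.coeff 0 = 1 := by
  have := X_pow_dvd_iff.mp h.2 0 (by omega)
  simp only [coeff_sub, coeff_one_zero] at this
  linarith

theorem IsResidual.coeff_one {n : ℕ} {P : ℝ[X]} (h : IsResidual 2 n P) : P.coeff 1 = 0 := by
  have := X_pow_dvd_iff.mp h.2 1 (by omega)
  simpa [Polynomial.coeff_one] using this

/-- The discrete inner product `∑ i ∈ s, w i * P (lam i) * Q (lam i)`. -/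
noncomputable def discreteInner (s : Finset ι) (w lam : ι → ℝ) : ℝ[X] →ₗ[ℝ] ℝ[X] →ₗ[ℝ] ℝ :=
  ∑ i ∈ s, w i • (leval (lam i)).smulRight (leval (lam i))

theorem discreteInner_apply (s : Finset ι) (w lam : ι → ℝ) (P Q : ℝ[X]) :
    discreteInner s w lam P Q = ∑ i ∈ s, w i * (P.eval (lam i) * Q.eval (lam i)) := by
  simp [discreteInner, LinearMap.sum_apply]

theorem discreteInner_self_nonneg {s : Finset ι} {w : ι → ℝ} (lam : ι → ℝ)
    (hw : ∀ i ∈ s, 0 ≤ w i) (P : ℝ[X]) : 0 ≤ discreteInner s w lam P P := by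
  rw [discreteInner_apply]
  exact Finset.sum_nonneg fun i hi => mul_nonneg (hw i hi) (mul_self_nonneg _)

/-- `P` is a minimizer of `∑ i ∈ s, w i * P (lam i) ^ 2` among residual polynomials. -/
def IsMinResidual (s : Finset ι) (w lam : ι → ℝ) (j n : ℕ) (P : ℝ[X]) : Prop :=
  IsResidual j n P ∧ ∀ v ∈ residualDirections j n, discreteInner s w lam P v = 0

theorem exists_isMinResidual {s : Finset ι} {w : ι → ℝ} (lam : ι → ℝ) (hw : ∀ i ∈ s, 0 ≤ w i)
    (j n : ℕ) : ∃ P, IsMinResidual s w lam j n P := by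
  classical
  let ev : ℝ[X] →ₗ[ℝ] EuclideanSpace ℝ s :=
    (WithLp.linearEquiv 2 ℝ (s → ℝ)).symm.toLinearMap ∘ₗ
      LinearMap.pi fun i : s => √(w i) • leval (lam i)
  have hev : ∀ P (i : s), ev P i = √(w i) * P.eval (lam i) := fun P i => rfl
  have hin : ∀ P Q, ⟪ev P, ev Q⟫_ℝ = discreteInner s w lam P Q := by
    intro P Q
    rw [discreteInner_apply, PiLp.inner_apply, ← Finset.sum_coe_sort s]
    refine Finset.sum_congr rfl fun i _ => ?_
    rw [hev, hev]
    have h1 : √(w i) * √(w i) = w i := Real.mul_self_sqrt (hw i i.2)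
    simp only [RCLike.inner_apply, conj_trivial]
    linear_combination (Q.eval (lam i) * P.eval (lam i)) * h1
  let W := (residualDirections j n).map ev
  obtain ⟨v, hv, hv'⟩ := Submodule.starProjection_apply_mem W (ev 1)
  refine ⟨1 - v, ?_, fun u hu => ?_⟩
  · have e : (1 : ℝ[X]) - v - 1 = -v := by ring
    rw [IsResidual, e]; exact Submodule.neg_mem _ hv
  · rw [← hin, map_sub, hv']
    exact Submodule.starProjection_inner_eq_zero _ _ (Submodule.mem_map_of_mem hu)

/-- Write P = FG for the interpolant and k = deg F. The difference X^k G − b(P₁ − P₀) equals (X^k −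
F)G + P₀, whose top degree cancels, so it is an admissible direction orthogonal to both P₀ and P₁.
Hence ⟨P, X^k G⟩ = b⟨P, P₁ − P₀⟩ = −b(1−b)‖P₁ − P₀‖². -/
theorem discreteInner_factor_nonpos {s : Finset ι} {w lam : ι → ℝ} (hw : ∀ i ∈ s, 0 ≤ w i)
    {j n : ℕ} (hj : 1 ≤ j) {P₀ P₁ F G : ℝ[X]} (h₀ : IsMinResidual s w lam j n P₀)
    (h₁ : IsMinResidual s w lam j (n + 1) P₁) {b : ℝ} (hb₀ : 0 ≤ b) (hb₁ : b ≤ 1)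
    (hP : (1 - b) • P₀ + b • P₁ = F * G) (hF : F.Monic) (hk : j ≤ F.natDegree) :
    discreteInner s w lam (F * G) (X ^ F.natDegree * G) ≤ 0 := by
  have hres : IsResidual j (n + 1) (F * G) := by
    rw [← hP]; exact h₀.1.mono.convex h₁.1 b
  have hd : P₁ - P₀ ∈ residualDirections j (n + 1) := h₁.1.sub_mem h₀.1.mono
  have hv : X ^ F.natDegree * G - b • (P₁ - P₀) ∈ residualDirections j n := by
    refine ⟨?_, dvd_sub (dvd_mul_of_dvd_left (pow_dvd_pow X hk) G) ?_⟩
    · have e : X ^ F.natDegree * G - b • (P₁ - P₀) = (X ^ F.natDegree - F) * G + P₀ := by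
        rw [sub_mul, ← hP]
        simp only [smul_sub, sub_smul, one_smul]; abel
      rw [e]
      refine (degree_add_le _ _).trans_lt (max_lt ?_ (h₀.1.degree_lt hj))
      rcases eq_or_ne G 0 with hG | hG
      · rw [hG, mul_zero, degree_zero]; exact WithBot.bot_lt_coe _
      have h1 : (X ^ F.natDegree - F).degree < F.degree := by
        rw [← degree_neg, neg_sub]
        refine degree_sub_lt_left ?_ hF.ne_zero ?_
        · rw [degree_X_pow, degree_eq_natDegree hF.ne_zero]
        · rw [hF.leadingCoeff, leadingCoeff_X_pow]
      have h2 : ((X ^ F.natDegree - F) * G).degree < (F * G).degree := by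
        rw [degree_mul, degree_mul]
        exact WithBot.add_lt_add_right (degree_ne_bot.mpr hG) h1
      have h3 := hres.degree_lt hj
      rw [degree_eq_natDegree (mul_ne_zero hF.ne_zero hG)] at h2 h3
      refine h2.trans_le ?_
      have h4 : (F * G).natDegree < n + 1 + j := by exact_mod_cast h3
      exact_mod_cast (by omega : (F * G).natDegree ≤ n + j)
    · exact ((residualDirections j (n + 1)).smul_mem b hd).2
  have hz : discreteInner s w lam (F * G) (X ^ F.natDegree * G - b • (P₁ - P₀)) = 0 := by
    rw [← hP, map_add, map_smul, map_smul, LinearMap.add_apply, LinearMap.smul_apply,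
      LinearMap.smul_apply, h₀.2 _ hv, h₁.2 _ (residualDirections_mono j n hv)]
    simp
  have h5 : discreteInner s w lam (F * G) (P₁ - P₀) =
      -((1 - b) * discreteInner s w lam (P₁ - P₀) (P₁ - P₀)) := by
    have h6 := h₁.2 _ hd
    rw [← hP, map_add, map_smul, map_smul, LinearMap.add_apply, LinearMap.smul_apply,
      LinearMap.smul_apply, h6]
    have h7 : discreteInner s w lam (P₁ - P₀) (P₁ - P₀)
        = discreteInner s w lam P₁ (P₁ - P₀) - discreteInner s w lam P₀ (P₁ - P₀) := by
      rw [map_sub (discreteInner s w lam), LinearMap.sub_apply]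
    rw [h7, h6]; simp only [smul_eq_mul, mul_zero, add_zero]; ring
  rw [map_sub, map_smul, h5, sub_eq_zero] at hz
  rw [hz, smul_eq_mul]
  have := discreteInner_self_nonneg lam hw (P₁ - P₀)
  have := mul_nonneg (sub_nonneg.mpr hb₁) this
  nlinarith

/-- Normalizing G at 0 suffices for j = 1. For j = 2 a further linear factor cancels the slope; the
extra degree is allowed by the bound n + j. -/
theorem exists_isResidual_of_dvd {j n : ℕ} (hj : j = 1 ∨ j = 2) {G : ℝ[X]}
    (hG : G.degree < ((n + 1 : ℕ) : WithBot ℕ)) (h0 : G.coeff 0 ≠ 0) :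
    ∃ Q, IsResidual j n Q ∧ G ∣ Q := by
  rcases hj with rfl | rfl
  · refine ⟨C (G.coeff 0)⁻¹ * G, ⟨?_, ?_⟩, dvd_mul_left _ _⟩
    · refine (degree_sub_le _ _).trans_lt (max_lt ?_ ?_)
      · rw [← smul_eq_C_mul]; exact (degree_smul_le _ _).trans_lt hG
      · rw [degree_one]; exact_mod_cast Nat.succ_pos n
    · rw [X_pow_dvd_iff]
      intro d hd
      obtain rfl : d = 0 := by omega
      simp [h0]
  · refine ⟨C (G.coeff 0)⁻¹ * G * (1 - C (G.coeff 1 / G.coeff 0) * X), ⟨?_, ?_⟩,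
      dvd_mul_of_dvd_left (dvd_mul_left _ _) _⟩
    · rw [degree_lt_iff_coeff_zero] at hG ⊢
      intro m hm
      obtain ⟨m, rfl⟩ : ∃ m', m = m' + 1 := ⟨m - 1, by omega⟩
      have h1 := hG (m + 1) (by omega)
      have h2 := hG m (by omega)
      rw [mul_sub, mul_one, coeff_sub, coeff_sub, ← mul_assoc, coeff_mul_X, coeff_mul_C,
        coeff_C_mul, coeff_C_mul, h1, h2, coeff_one]
      simp
    · rw [X_pow_dvd_iff]
      intro d hd
      interval_cases d
      · simp [h0]
      · rw [mul_sub, mul_one, coeff_sub, coeff_sub, ← mul_assoc, coeff_mul_X, coeff_mul_C,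
          coeff_C_mul, coeff_C_mul, coeff_one]
        simp; field_simp; simp

/-- Otherwise the sum in `discreteInner_factor_nonpos` has nonnegative terms and a nonpositive
total, so G vanishes at every node, and a residual multiple of G contradicts `hNV`. Suitable factors
F then locate the roots of the interpolant. -/
theorem exists_eval_factor_nonpos {s : Finset ι} {w lam : ι → ℝ} (hw : ∀ i ∈ s, 0 < w i)
    {j n : ℕ} (hj : j = 1 ∨ j = 2) {P₀ P₁ F G : ℝ[X]} (h₀ : IsMinResidual s w lam j n P₀)
    (h₁ : IsMinResidual s w lam j (n + 1) P₁) {b : ℝ} (hb₀ : 0 ≤ b) (hb₁ : b ≤ 1)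
    (hP : (1 - b) • P₀ + b • P₁ = F * G) (hF : F.Monic) (hk : j ≤ F.natDegree)
    (hNV : ∀ Q, IsResidual j n Q → ∃ i ∈ s, Q.eval (lam i) ≠ 0) :
    ∃ i ∈ s, F.eval (lam i) * lam i ^ F.natDegree ≤ 0 := by
  by_contra! hcon
  have hj1 : 1 ≤ j := by omega
  have hle := discreteInner_factor_nonpos (fun i hi => (hw i hi).le) hj1 h₀ h₁ hb₀ hb₁ hP hF hk
  have hres : IsResidual j (n + 1) (F * G) := by
    rw [← hP]; exact h₀.1.mono.convex h₁.1 b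
  rw [discreteInner_apply] at hle
  have hterm : ∀ i ∈ s, w i * ((F * G).eval (lam i) * (X ^ F.natDegree * G).eval (lam i)) =
      w i * (F.eval (lam i) * lam i ^ F.natDegree) * G.eval (lam i) ^ 2 := by
    intro i _
    simp only [eval_mul, eval_pow, eval_X]; ring
  rw [Finset.sum_congr rfl hterm] at hle
  have hnn : ∀ i ∈ s, 0 ≤ w i * (F.eval (lam i) * lam i ^ F.natDegree) * G.eval (lam i) ^ 2 :=
    fun i hi => mul_nonneg (mul_pos (hw i hi) (hcon i hi)).le (sq_nonneg _)
  have hzero := (Finset.sum_eq_zero_iff_of_nonneg hnn).mp (le_antisymm hle (Finset.sum_nonneg hnn))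
  have hG0 : G.coeff 0 ≠ 0 := by
    intro h
    have := hres.coeff_zero hj1
    rw [mul_coeff_zero, h, mul_zero] at this
    exact zero_ne_one this
  have hGne : G ≠ 0 := by rintro rfl; simp at hG0
  have hdeg : G.degree < ((n + 1 : ℕ) : WithBot ℕ) := by
    have h3 := hres.degree_lt hj1
    rw [degree_eq_natDegree (mul_ne_zero hF.ne_zero hGne), hF.natDegree_mul' hGne] at h3
    have h4 : F.natDegree + G.natDegree < n + 1 + j := by exact_mod_cast h3
    rw [degree_eq_natDegree hGne]
    exact_mod_cast (by omega : G.natDegree < n + 1)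
  obtain ⟨Q, hQ, T, rfl⟩ := exists_isResidual_of_dvd hj hdeg hG0
  obtain ⟨i, hi, hne⟩ := hNV _ hQ
  have h1 := hzero i hi
  have h2 : G.eval (lam i) = 0 := by
    by_contra h
    exact (mul_pos (mul_pos (hw i hi) (hcon i hi)) (by positivity)).ne' h1
  exact hne (by rw [eval_mul, h2, zero_mul])

/-- The polynomial `∏ (1 - z X)` with reciprocal roots `Z`. -/
noncomputable def prodOneSub (Z : Multiset ℝ) : ℝ[X] := (Z.map fun z => 1 - C z * X).prod

theorem prodOneSub_cons (z : ℝ) (Z : Multiset ℝ) :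
    prodOneSub (z ::ₘ Z) = (1 - C z * X) * prodOneSub Z := by
  simp [prodOneSub]

theorem eval_prodOneSub_cons (z : ℝ) (Z : Multiset ℝ) (x : ℝ) :
    (prodOneSub (z ::ₘ Z)).eval x = (1 - z * x) * (prodOneSub Z).eval x := by
  simp [prodOneSub_cons]

theorem coeff_prodOneSub (Z : Multiset ℝ) :
    (prodOneSub Z).coeff 0 = 1 ∧ (prodOneSub Z).coeff 1 = -Z.sum := by
  induction Z using Multiset.induction_on with
  | empty => simp [prodOneSub, coeff_one]
  | cons z Z ih =>
    rw [prodOneSub_cons, Multiset.sum_cons]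
    constructor
    · rw [mul_coeff_zero, ih.1]; simp
    · rw [sub_mul, one_mul, mul_assoc, coeff_sub, coeff_C_mul, coeff_X_mul, ih.1, ih.2]; ring

theorem eval_prodOneSub_bounds {Z : Multiset ℝ} {x : ℝ} (h : ∀ z ∈ Z, z * x ≤ 1) :
    0 ≤ (prodOneSub Z).eval x ∧ (prodOneSub Z).eval x ≤ Real.exp (-(x * Z.sum)) := by
  induction Z using Multiset.induction_on with
  | empty => simp [prodOneSub]
  | cons z Z ih =>
    obtain ⟨h1, h2⟩ := ih fun a ha => h a (Multiset.mem_cons_of_mem ha)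
    have h3 := h z (Multiset.mem_cons_self z Z)
    rw [eval_prodOneSub_cons]
    refine ⟨mul_nonneg (by linarith) h1, ?_⟩
    have e : -(x * (z ::ₘ Z).sum) = -(z * x) + -(x * Z.sum) := by
      rw [Multiset.sum_cons]; ring
    rw [e, Real.exp_add]
    refine mul_le_mul ?_ h2 h1 (Real.exp_pos _).le
    have := Real.add_one_le_exp (-(z * x))
    linarith

theorem exists_eq_prodOneSub {P : ℝ[X]} (h0 : P.coeff 0 = 1)
    (hreal : ∀ z : ℂ, aeval z P = 0 → z.im = 0) :
    ∃ Z : Multiset ℝ, P = prodOneSub Z ∧ (0 : ℝ) ∉ Z := by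
  have hP : P ≠ 0 := by rintro rfl; simp at h0
  have hs : P.Splits := by
    refine Splits.of_splits_map (algebraMap ℝ ℂ) (IsAlgClosed.splits _) fun a ha => ?_
    have h1 : aeval a P = 0 := by
      have := isRoot_of_mem_roots ha
      rwa [IsRoot, eval_map_algebraMap] at this
    exact ⟨a.re, Complex.ext (by simp) (by simp [hreal a h1])⟩
  have hne : ∀ a ∈ P.roots, a ≠ 0 := by
    rintro a ha rfl
    have := isRoot_of_mem_roots ha
    rw [IsRoot, ← coeff_zero_eq_eval_zero, h0] at this
    exact one_ne_zero this
  have key : ∀ R : Multiset ℝ, (∀ a ∈ R, a ≠ 0) →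
      ∃ c, (R.map fun x => X - C x).prod = C c * prodOneSub (R.map fun a => a⁻¹) := by
    intro R
    induction R using Multiset.induction_on with
    | empty => exact fun _ => ⟨1, by simp [prodOneSub]⟩
    | cons a R ih =>
      intro h
      obtain ⟨c, hc⟩ := ih fun x hx => h x (Multiset.mem_cons_of_mem hx)
      have ha := h a (Multiset.mem_cons_self a R)
      refine ⟨-a * c, ?_⟩
      rw [Multiset.map_cons, Multiset.prod_cons, hc, Multiset.map_cons, prodOneSub_cons]
      have : (X : ℝ[X]) - C a = C (-a) * (1 - C a⁻¹ * X) := by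
        rw [mul_sub, ← mul_assoc, ← C_mul]
        simp [ha]; ring
      rw [this, C_mul]; ring
  obtain ⟨c, hc⟩ := key P.roots hne
  have h1 := hs.eq_prod_roots
  rw [hc, ← mul_assoc, ← C_mul] at h1
  have h2 : P.leadingCoeff * c = 1 := by
    have := congrArg (fun Q : ℝ[X] => Q.coeff 0) h1
    simpa [h0, (coeff_prodOneSub _).1, mul_coeff_zero] using this.symm
  rw [h2, C_1, one_mul] at h1
  refine ⟨_, h1, fun h => ?_⟩
  obtain ⟨a, ha, ha'⟩ := Multiset.mem_map.mp h
  exact hne a ha (inv_eq_zero.mp ha')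

end ResidualPolynomials

end NewtonMR

namespace NewtonMR

open Polynomial

/-! ### Roots of interpolated minimal residual polynomials. -/

section ResidualRoots

variable {ι : Type*} {s : Finset ι} {w lam : ι → ℝ} {j n : ℕ} {P₀ P₁ : ℝ[X]} {b K : ℝ}

/-- A convex combination of two consecutive minimal residual polynomials is real-rooted, at most
one of its roots lies in the gap `(-K, K)` of the nodes, and none does if `j = 1`. -/
theorem exists_reciprocal_roots (hw : ∀ i ∈ s, 0 < w i) (hK : 0 < K) (hlam : ∀ i ∈ s, K ≤ |lam i|)
    (hj : j = 1 ∨ j = 2) (h₀ : IsMinResidual s w lam j n P₀)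
    (h₁ : IsMinResidual s w lam j (n + 1) P₁) (hb₀ : 0 ≤ b) (hb₁ : b ≤ 1)
    (hNV : ∀ Q, IsResidual j n Q → ∃ i ∈ s, Q.eval (lam i) ≠ 0) :
    ∃ Z : Multiset ℝ, (1 - b) • P₀ + b • P₁ = prodOneSub Z ∧ (0 : ℝ) ∉ Z ∧
      (∀ z z' Z', Z = z ::ₘ z' ::ₘ Z' → |z| * K ≤ 1 ∨ |z'| * K ≤ 1) ∧
      (j = 1 → ∀ z ∈ Z, |z| * K ≤ 1) := by
  have hj1 : 1 ≤ j := by omega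
  have hne : ∀ i ∈ s, lam i ≠ 0 := fun i hi h => by
    have := hlam i hi; rw [h, abs_zero] at this; linarith
  have main : ∀ F G : ℝ[X], (1 - b) • P₀ + b • P₁ = F * G → F.Monic → j ≤ F.natDegree →
      ∃ i ∈ s, F.eval (lam i) * lam i ^ F.natDegree ≤ 0 := fun F G hP hF hk =>
    exists_eval_factor_nonpos hw hj h₀ h₁ hb₀ hb₁ hP hF hk hNV
  obtain ⟨Z, hZ, hZ0⟩ := exists_eq_prodOneSub ((h₀.1.mono.convex h₁.1 b).coeff_zero hj1) (by
    intro z hz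
    by_contra him
    -- A conjugate pair of nonreal roots gives a quadratic factor positive on the whole real line.
    obtain ⟨G, hG⟩ := quadratic_dvd_of_aeval_eq_zero_im_ne_zero _ hz him
    have hdeg : (X ^ 2 - C (2 * z.re) * X + C (‖z‖ ^ 2) : ℝ[X]).natDegree = 2 := by
      compute_degree!
    have hmon : (X ^ 2 - C (2 * z.re) * X + C (‖z‖ ^ 2) : ℝ[X]).Monic := by
      monicity!
    obtain ⟨i, hi, hle⟩ := main _ G hG hmon (by rw [hdeg]; omega)
    rw [hdeg] at hle
    refine hle.not_gt (mul_pos ?_ (sq_pos_of_ne_zero (hne i hi)))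
    have h1 : ‖z‖ ^ 2 = z.re ^ 2 + z.im ^ 2 := by
      rw [Complex.sq_norm, Complex.normSq_apply]; ring
    have h2 : 0 < z.im ^ 2 := by positivity
    simp only [eval_add, eval_sub, eval_pow, eval_X, eval_mul, eval_C, h1]
    nlinarith [sq_nonneg (lam i - z.re)])
  have hgap : ∀ z, z ≠ 0 → 1 < |z| * K → |z⁻¹| < K := by
    intro z hz h
    rw [abs_inv, inv_lt_iff_one_lt_mul₀ (abs_pos.mpr hz)]; linarith
  have hfac : ∀ z : ℝ, z ≠ 0 → (1 - C z * X : ℝ[X]) = (X - C z⁻¹) * C (-z) := by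
    intro z hz
    rw [sub_mul, ← C_mul]; simp [hz]; ring
  refine ⟨Z, hZ, hZ0, ?_, ?_⟩
  · rintro z z' Z' rfl
    by_contra! hcon
    have hz : z ≠ 0 := fun h => hZ0 (by simp [h])
    have hz' : z' ≠ 0 := fun h => hZ0 (by simp [h])
    have hmon : ((X - C z⁻¹) * (X - C z'⁻¹) : ℝ[X]).Monic :=
      (monic_X_sub_C _).mul (monic_X_sub_C _)
    have hdeg : ((X - C z⁻¹) * (X - C z'⁻¹) : ℝ[X]).natDegree = 2 := by
      rw [(monic_X_sub_C _).natDegree_mul (monic_X_sub_C _)]; simp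
    -- For two roots in the gap, both linear factors have the sign of the node, so their product is
    -- positive at every node.
    obtain ⟨i, hi, hle⟩ := main ((X - C z⁻¹) * (X - C z'⁻¹)) (C (-z) * C (-z') * prodOneSub Z')
      (by rw [hZ, prodOneSub_cons, prodOneSub_cons, hfac z hz, hfac z' hz']; ring) hmon
      (by rw [hdeg]; omega)
    rw [hdeg] at hle
    refine hle.not_gt (mul_pos ?_ (sq_pos_of_ne_zero (hne i hi)))
    have h1 := abs_lt.mp (hgap z hz hcon.1)
    have h2 := abs_lt.mp (hgap z' hz' hcon.2)
    simp only [eval_mul, eval_sub, eval_X, eval_C]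
    rcases le_abs.mp (hlam i hi) with h | h
    · exact mul_pos (by linarith) (by linarith)
    · exact mul_pos_of_neg_of_neg (by linarith) (by linarith)
  · rintro rfl z hzZ
    by_contra! hcon
    obtain ⟨Z', rfl⟩ := Multiset.exists_cons_of_mem hzZ
    have hz : z ≠ 0 := fun h => hZ0 (by simp [h])
    obtain ⟨i, hi, hle⟩ := main (X - C z⁻¹) (C (-z) * prodOneSub Z')
      (by rw [hZ, prodOneSub_cons, hfac z hz]; ring) (monic_X_sub_C _)
      (by rw [natDegree_X_sub_C])
    rw [natDegree_X_sub_C, pow_one] at hle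
    refine hle.not_gt ?_
    have h1 := abs_lt.mp (hgap z hz hcon)
    simp only [eval_sub, eval_X, eval_C]
    rcases le_abs.mp (hlam i hi) with h | h
    · exact mul_pos (by linarith) (by linarith)
    · exact mul_pos_of_neg_of_neg (by linarith) (by linarith)

/-- This is `discreteInner_factor_nonpos` for F = X − z⁻¹. Passing to reciprocal roots flips the
sign; for a quadratic factor the two flips cancel. -/
theorem sum_mul_root_nonneg (hw : ∀ i ∈ s, 0 ≤ w i) (h₀ : IsMinResidual s w lam 1 n P₀)
    (h₁ : IsMinResidual s w lam 1 (n + 1) P₁) (hb₀ : 0 ≤ b) (hb₁ : b ≤ 1) {z : ℝ} (hz : z ≠ 0)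
    {Z : Multiset ℝ} (hZ : (1 - b) • P₀ + b • P₁ = prodOneSub (z ::ₘ Z)) :
    0 ≤ ∑ i ∈ s, w i * (z * lam i * (1 - z * lam i) * (prodOneSub Z).eval (lam i) ^ 2) := by
  have hfac : (1 - C z * X : ℝ[X]) = (X - C z⁻¹) * C (-z) := by
    rw [sub_mul, ← C_mul]; simp [hz]; ring
  have h := discreteInner_factor_nonpos hw le_rfl h₀ h₁ hb₀ hb₁ (F := X - C z⁻¹)
    (G := C (-z) * prodOneSub Z) (by rw [hZ, prodOneSub_cons, hfac]; ring) (monic_X_sub_C _)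
    (by rw [natDegree_X_sub_C])
  rw [natDegree_X_sub_C, discreteInner_apply, ← neg_nonneg, ← Finset.sum_neg_distrib] at h
  refine h.trans_eq (Finset.sum_congr rfl fun i _ => ?_)
  simp only [eval_mul, eval_sub, eval_X, eval_C, eval_pow]
  field_simp; ring

theorem sum_mul_roots_nonpos (hw : ∀ i ∈ s, 0 ≤ w i) (h₀ : IsMinResidual s w lam 2 n P₀)
    (h₁ : IsMinResidual s w lam 2 (n + 1) P₁) (hb₀ : 0 ≤ b) (hb₁ : b ≤ 1) {z z' : ℝ} (hz : z ≠ 0)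
    (hz' : z' ≠ 0) {Z : Multiset ℝ} (hZ : (1 - b) • P₀ + b • P₁ = prodOneSub (z ::ₘ z' ::ₘ Z)) :
    ∑ i ∈ s, w i * (z * lam i * (1 - z * lam i) * (z' * lam i * (1 - z' * lam i)) *
      (prodOneSub Z).eval (lam i) ^ 2) ≤ 0 := by
  have hfac : ∀ z : ℝ, z ≠ 0 → (1 - C z * X : ℝ[X]) = (X - C z⁻¹) * C (-z) := by
    intro z hz
    rw [sub_mul, ← C_mul]; simp [hz]; ring
  have hdeg : ((X - C z⁻¹) * (X - C z'⁻¹) : ℝ[X]).natDegree = 2 := by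
    rw [(monic_X_sub_C _).natDegree_mul (monic_X_sub_C _)]; simp
  have h := discreteInner_factor_nonpos hw one_le_two h₀ h₁ hb₀ hb₁
    (F := (X - C z⁻¹) * (X - C z'⁻¹)) (G := C (-z) * C (-z') * prodOneSub Z)
    (by rw [hZ, prodOneSub_cons, prodOneSub_cons, hfac z hz, hfac z' hz']; ring)
    ((monic_X_sub_C _).mul (monic_X_sub_C _)) (by rw [hdeg])
  rw [hdeg, discreteInner_apply] at h
  refine h.trans_eq' (Finset.sum_congr rfl fun i _ => ?_)
  simp only [eval_mul, eval_sub, eval_X, eval_C, eval_pow]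
  field_simp; ring

end ResidualRoots

/-! ### Decay of residual polynomials on nodes outside the gap. -/

section Decay

/-- A pointwise bound from which the size of an amplifying residual polynomial follows by
summation. -/
theorem decay_pointwise {K ε z t E y g : ℝ} (hε : 0 < ε) (hK : 3 * ε ≤ K) (hz : 0 < z)
    (hzK : z * K ≤ 1) (ht : K ≤ |t|) (hy₁ : t < 0 → 1 ≤ y) (hy₂ : 0 < t → 1 / 2 ≤ y ∧ y ≤ 1)
    (hT : 0 < t → z * t ≤ 1 → (E * g) ^ 2 ≤ Real.exp (2 * (z * t)) * (3 / (1 + t / ε) ^ 3)) :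
    (E * ((1 - z * t) * g)) ^ 2 +
      (1 + 1 / (z * K)) * (E ^ 2 * y * (z * t * (1 - z * t) * g ^ 2)) ≤
      3 * Real.exp 1 / (1 + K / ε) ^ 3 := by
  have hK0 : 0 < K := by linarith
  set u := z * K with hu
  have hu0 : 0 < u := mul_pos hz hK0
  set x := z * t with hx
  have hR : 0 < 3 * Real.exp 1 / (1 + K / ε) ^ 3 := by positivity
  -- The multiplier 1 + 1/u is the one for which, with y = 1, the last factor becomes 1 + x/u and
  -- vanishes at t = −K. The expression is nonpositive for t < 0 and for x ≥ 1; only 0 < x < 1 needs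
  -- an estimate.
  have e : (E * ((1 - x) * g)) ^ 2 + (1 + 1 / u) * (E ^ 2 * y * (x * (1 - x) * g ^ 2)) =
      (E * g) ^ 2 * ((1 - x) * ((1 - x) + (1 + 1 / u) * (y * x))) := by ring
  rw [e]
  have h1u : 1 ≤ 1 / u := by rw [le_div_iff₀ hu0]; linarith
  rcases lt_or_gt_of_ne (show t ≠ 0 by rintro rfl; rw [abs_zero] at ht; linarith) with hneg | hpos
  · have hxu : x ≤ -u := by
      rw [abs_of_neg hneg] at ht
      nlinarith
    have h1 : (1 + 1 / u) * (y * x) ≤ (1 + 1 / u) * x := by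
      have := hy₁ hneg
      refine mul_le_mul_of_nonneg_left ?_ (by linarith)
      nlinarith
    have h2 : 1 / u * x ≤ -1 := by
      rw [div_mul_eq_mul_div, one_mul, div_le_iff₀ hu0]; linarith
    refine le_trans (mul_nonpos_of_nonneg_of_nonpos (sq_nonneg _) ?_) hR.le
    exact mul_nonpos_of_nonneg_of_nonpos (by linarith) (by nlinarith)
  · have hxpos : 0 < x := mul_pos hz hpos
    rw [abs_of_pos hpos] at ht
    obtain ⟨hyl, hyu⟩ := hy₂ hpos
    rcases le_or_gt 1 x with h1x | hx1
    · refine le_trans (mul_nonpos_of_nonneg_of_nonpos (sq_nonneg _) ?_) hR.le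
      refine mul_nonpos_of_nonpos_of_nonneg (by linarith) ?_
      have h1 : 2 * (1 / 2 * x) ≤ (1 + 1 / u) * (y * x) :=
        mul_le_mul (by linarith) (mul_le_mul_of_nonneg_right hyl hxpos.le) (by positivity)
          (by linarith)
      linarith
    · have hq : x / u = t / K := by rw [hx, hu]; field_simp
      have hq1 : 1 ≤ t / K := by rw [le_div_iff₀ hK0]; linarith
      have h1 : (1 - x) + (1 + 1 / u) * (y * x) ≤ 1 + t / K := by
        have : (1 + 1 / u) * (y * x) ≤ (1 + 1 / u) * x :=
          mul_le_mul_of_nonneg_left (by nlinarith) (by linarith)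
        have e2 : (1 + 1 / u) * x = x + x / u := by ring
        rw [← hq]; linarith
      -- The maximum is at x = 1/2, whence the tangent line of exp at 1 − 2x = 0.
      have h2 : (1 - x) * Real.exp (2 * x) ≤ Real.exp 1 / 2 := by
        have h3 := Real.add_one_le_exp (1 - 2 * x)
        have h4 : Real.exp 1 = Real.exp (1 - 2 * x) * Real.exp (2 * x) := by
          rw [← Real.exp_add]; congr 1; ring
        rw [h4]
        have := Real.exp_pos (2 * x)
        nlinarith
      have h5 : (1 + t / K) * (3 / (1 + t / ε) ^ 3) ≤ 2 * (3 / (1 + K / ε) ^ 3) := by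
        have ha : 3 ≤ K / ε := by rw [le_div_iff₀ hε]; exact hK
        have hb : t / ε = t / K * (K / ε) := by field_simp
        rw [hb]
        set q := t / K
        set k := K / ε
        have h6 : (1 + q) * (1 + k) ≤ 2 * (1 + q * k) := by nlinarith
        have h7 : 1 + k ≤ 1 + q * k := by nlinarith
        have h8 : (1 + k) ^ 2 ≤ (1 + q * k) ^ 2 := by gcongr
        rw [mul_div_assoc' (1 + q), mul_div_assoc' 2, div_le_div_iff₀ (by positivity) (by positivity)]
        have h9 := mul_le_mul h6 h8 (by positivity) (by positivity)
        nlinarith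
      calc (E * g) ^ 2 * ((1 - x) * ((1 - x) + (1 + 1 / u) * (y * x)))
          ≤ (Real.exp (2 * x) * (3 / (1 + t / ε) ^ 3)) * ((1 - x) * (1 + t / K)) := by
            refine mul_le_mul (hT hpos hx1.le) (mul_le_mul_of_nonneg_left h1 (by linarith)) ?_
              (by positivity)
            refine mul_nonneg (by linarith) ?_
            have : 0 ≤ (1 + 1 / u) * (y * x) := by
              refine mul_nonneg (by linarith) (mul_nonneg (by linarith) hxpos.le)
            linarith
        _ = ((1 - x) * Real.exp (2 * x)) * ((1 + t / K) * (3 / (1 + t / ε) ^ 3)) := by ring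
        _ ≤ (Real.exp 1 / 2) * (2 * (3 / (1 + K / ε) ^ 3)) := by
            refine mul_le_mul h2 h5 (by positivity) (by positivity)
        _ = 3 * Real.exp 1 / (1 + K / ε) ^ 3 := by ring

variable {ι : Type*} {s : Finset ι} {w lam : ι → ℝ} {ε K : ℝ}

/-- Let z be the largest reciprocal root. A positive multiple of the relation `hH` for z, added to
the sum of squares, leaves positive terms only at nodes 0 < t < 1/z. There each remaining factor
satisfies 0 ≤ 1 − at ≤ exp(−at), so their product is at most exp(−t(Z.sum − z)). The function `E`
carries a possible root in the gap, and `y` adapts the relation to it. -/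
theorem sum_sq_le_of_decay (hw : ∀ i ∈ s, 0 ≤ w i) (hε : 0 < ε) (hK : 3 * ε ≤ K)
    (hlam : ∀ i ∈ s, K ≤ |lam i|) {Z : Multiset ℝ} (hZ : ∀ z ∈ Z, |z| * K ≤ 1)
    (hsum : 0 < Z.sum) (E y : ℝ → ℝ) (hy₁ : ∀ t ≤ -K, 1 ≤ y t)
    (hy₂ : ∀ t, K ≤ t → 1 / 2 ≤ y t ∧ y t ≤ 1)
    (hT : ∀ t, K ≤ t → E t ^ 2 * Real.exp (-(2 * (t * Z.sum))) ≤ 3 / (1 + t / ε) ^ 3)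
    (hH : ∀ z Z', Z = z ::ₘ Z' → 0 ≤ ∑ i ∈ s, w i * (E (lam i) ^ 2 * y (lam i) *
      (z * lam i * (1 - z * lam i) * (prodOneSub Z').eval (lam i) ^ 2))) :
    ∑ i ∈ s, w i * (E (lam i) * (prodOneSub Z).eval (lam i)) ^ 2 ≤
      3 * Real.exp 1 / (1 + K / ε) ^ 3 * ∑ i ∈ s, w i := by
  have hK0 : 0 < K := by linarith
  have hne : Z.toFinset.Nonempty := by
    rw [Multiset.toFinset_nonempty]
    rintro rfl
    simp at hsum
  obtain ⟨z, hzZ, hmax⟩ := Z.toFinset.exists_max_image id hne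
  rw [Multiset.mem_toFinset] at hzZ
  replace hmax : ∀ a ∈ Z, a ≤ z := fun a ha => hmax a (Multiset.mem_toFinset.mpr ha)
  have hz : 0 < z := by
    by_contra! h
    have := Z.sum_le_card_nsmul 0 fun a ha => (hmax a ha).trans h
    rw [smul_zero] at this
    linarith
  have hzK := hZ z hzZ
  rw [abs_of_pos hz] at hzK
  obtain ⟨Z', rfl⟩ := Multiset.exists_cons_of_mem hzZ
  have hH' := hH z Z' rfl
  have hc : 0 ≤ 1 + 1 / (z * K) := by positivity
  have hpt : ∀ i ∈ s, w i * (E (lam i) * (prodOneSub (z ::ₘ Z')).eval (lam i)) ^ 2 +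
      (1 + 1 / (z * K)) * (w i * (E (lam i) ^ 2 * y (lam i) *
      (z * lam i * (1 - z * lam i) * (prodOneSub Z').eval (lam i) ^ 2))) ≤
      3 * Real.exp 1 / (1 + K / ε) ^ 3 * w i := by
    intro i hi
    have h := decay_pointwise (t := lam i) (E := E (lam i)) (y := y (lam i))
      (g := (prodOneSub Z').eval (lam i)) hε hK hz hzK (hlam i hi)
      (fun h => hy₁ _ (by have := hlam i hi; rw [abs_of_neg h] at this; linarith))
      (fun h => hy₂ _ (by have := hlam i hi; rwa [abs_of_pos h] at this)) (by
        intro hpos hx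
        have htK : K ≤ lam i := by have := hlam i hi; rwa [abs_of_pos hpos] at this
        obtain ⟨h1, h2⟩ := eval_prodOneSub_bounds (Z := Z') (x := lam i) fun a ha =>
          (mul_le_mul_of_nonneg_right (hmax a (Multiset.mem_cons_of_mem ha)) hpos.le).trans hx
        have h3 := pow_le_pow_left₀ h1 h2 2
        have h4 := hT _ htK
        rw [mul_pow]
        refine (mul_le_mul_of_nonneg_left h3 (sq_nonneg _)).trans ?_
        have e : Real.exp (-(lam i * Z'.sum)) ^ 2 =
            Real.exp (2 * (z * lam i)) * Real.exp (-(2 * (lam i * (z ::ₘ Z').sum))) := by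
          rw [← Real.exp_nat_mul, ← Real.exp_add, Multiset.sum_cons]
          congr 1; push_cast; ring
        rw [e, mul_left_comm]
        exact mul_le_mul_of_nonneg_left h4 (Real.exp_pos _).le)
    rw [eval_prodOneSub_cons]
    have := mul_le_mul_of_nonneg_left h (hw i hi)
    linarith
  have h := Finset.sum_le_sum hpt
  rw [Finset.sum_add_distrib, ← Finset.mul_sum, ← Finset.mul_sum] at h
  have := mul_nonneg hc hH'
  linarith

/-- The tangent of exp touching at m = 3, the least value of t/ε on the large nodes. -/
theorem one_add_le_exp_quarter (m : ℝ) : 1 + m ≤ 4 * Real.exp ((m - 3) / 4) := by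
  have := Real.add_one_le_exp ((m - 3) / 4)
  linarith

theorem exp_neg_four_thirds_le {m : ℝ} (hm : 3 ≤ m) :
    Real.exp (-(4 / 3 * m)) ≤ 3 / (1 + m) ^ 3 := by
  rw [le_div_iff₀ (by positivity)]
  have h1 : (1 + m) ^ 3 ≤ (4 * Real.exp ((m - 3) / 4)) ^ 3 :=
    pow_le_pow_left₀ (by linarith) (one_add_le_exp_quarter m) 3
  have h2 : (4 * Real.exp ((m - 3) / 4)) ^ 3 = 64 * Real.exp (3 / 4 * (m - 3)) := by
    rw [mul_pow, ← Real.exp_nat_mul]; norm_num; ring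
  have h3 : Real.exp (-(4 / 3 * m)) * Real.exp (3 / 4 * (m - 3)) ≤ Real.exp (-4) := by
    rw [← Real.exp_add, Real.exp_le_exp]; linarith
  have h4 : Real.exp (-4) ≤ 1 / 27 := by
    rw [Real.exp_neg, ← one_div]
    refine one_div_le_one_div_of_le (by norm_num) ?_
    have h5 : Real.exp 4 = Real.exp 1 ^ 4 := by rw [← Real.exp_nat_mul]; norm_num
    have h6 := Real.exp_one_gt_d9
    rw [h5]
    calc (27 : ℝ) ≤ 2.7 ^ 4 := by norm_num
      _ ≤ _ := pow_le_pow_left₀ (by norm_num) (by linarith) 4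
  have h7 := mul_le_mul_of_nonneg_left h1 (Real.exp_pos (-(4 / 3 * m))).le
  rw [h2] at h7
  nlinarith

theorem sq_mul_exp_neg_two_le {m : ℝ} (hm : 3 ≤ m) :
    (1 + m) ^ 2 * Real.exp (-(2 * m)) ≤ 3 / (1 + m) ^ 3 := by
  rw [le_div_iff₀ (by positivity)]
  have h1 : (1 + m) ^ 5 ≤ (4 * Real.exp ((m - 3) / 4)) ^ 5 :=
    pow_le_pow_left₀ (by linarith) (one_add_le_exp_quarter m) 5
  have h2 : (4 * Real.exp ((m - 3) / 4)) ^ 5 = 1024 * Real.exp (5 / 4 * (m - 3)) := by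
    rw [mul_pow, ← Real.exp_nat_mul]; norm_num; ring
  have h3 : Real.exp (-(2 * m)) * Real.exp (5 / 4 * (m - 3)) ≤ Real.exp (-6) := by
    rw [← Real.exp_add, Real.exp_le_exp]; linarith
  have h4 : Real.exp (-6) ≤ 1 / 380 := by
    rw [Real.exp_neg, ← one_div]
    refine one_div_le_one_div_of_le (by norm_num) ?_
    have h5 : Real.exp 6 = Real.exp 1 ^ 6 := by rw [← Real.exp_nat_mul]; norm_num
    have h6 := Real.exp_one_gt_d9
    rw [h5]
    calc (380 : ℝ) ≤ 2.7 ^ 6 := by norm_num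
      _ ≤ _ := pow_le_pow_left₀ (by norm_num) (by linarith) 6
  have h7 := mul_le_mul_of_nonneg_left h1 (Real.exp_pos (-(2 * m))).le
  rw [h2] at h7
  nlinarith

/-- Residual polynomials without roots in the gap `(-K, K)` and of large slope at `0` are small on
nodes outside the gap. -/
theorem sum_sq_le_of_slope (hw : ∀ i ∈ s, 0 ≤ w i) (hε : 0 < ε) (hK : 3 * ε ≤ K)
    (hlam : ∀ i ∈ s, K ≤ |lam i|) {Z : Multiset ℝ} (hZ : ∀ z ∈ Z, |z| * K ≤ 1)
    (hsum : Z.sum = 2 / (3 * ε))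
    (hH : ∀ z Z', Z = z ::ₘ Z' → 0 ≤ ∑ i ∈ s, w i *
      (z * lam i * (1 - z * lam i) * (prodOneSub Z').eval (lam i) ^ 2)) :
    ∑ i ∈ s, w i * (prodOneSub Z).eval (lam i) ^ 2 ≤
      3 * Real.exp 1 / (1 + K / ε) ^ 3 * ∑ i ∈ s, w i := by
  have h := sum_sq_le_of_decay hw hε hK hlam hZ (by rw [hsum]; positivity) (fun _ => 1)
    (fun _ => 1) (fun _ _ => le_rfl) (fun _ _ => by norm_num) (fun t ht => ?_)
    (fun z Z' h => by simpa using hH z Z' h)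
  · simpa using h
  · have h1 : 3 ≤ t / ε := by rw [le_div_iff₀ hε]; linarith
    have h2 := exp_neg_four_thirds_le h1
    have e : -(2 * (t * Z.sum)) = -(4 / 3 * (t / ε)) := by rw [hsum]; field_simp; ring
    rw [e]; simpa using h2

/-- Residual polynomials of slope `0` with the only root `-ε` in the gap `(-K, K)` are small on
nodes outside the gap. -/
theorem sum_sq_le_of_root (hw : ∀ i ∈ s, 0 ≤ w i) (hε : 0 < ε) (hK : 3 * ε ≤ K)
    (hlam : ∀ i ∈ s, K ≤ |lam i|) {Z : Multiset ℝ} (hZ : ∀ z ∈ Z, |z| * K ≤ 1)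
    (hsum : Z.sum = 1 / ε)
    (hH : ∀ z Z', Z = z ::ₘ Z' → 0 ≤ ∑ i ∈ s, w i * (lam i / ε * (1 + lam i / ε) *
      (z * lam i * (1 - z * lam i)) * (prodOneSub Z').eval (lam i) ^ 2)) :
    ∑ i ∈ s, w i * ((1 + lam i / ε) * (prodOneSub Z).eval (lam i)) ^ 2 ≤
      3 * Real.exp 1 / (1 + K / ε) ^ 3 * ∑ i ∈ s, w i := by
  refine sum_sq_le_of_decay hw hε hK hlam hZ (by rw [hsum]; positivity) (fun t => 1 + t / ε)
    (fun t => t / (t + ε)) (fun t ht => ?_) (fun t ht => ⟨?_, ?_⟩) (fun t ht => ?_)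
    (fun z Z' h => ?_)
  · rw [le_div_iff_of_neg (by linarith)]; linarith
  · rw [le_div_iff₀ (by linarith)]; linarith
  · rw [div_le_one (by linarith)]; linarith
  · have h1 : 3 ≤ t / ε := by rw [le_div_iff₀ hε]; linarith
    have h2 := sq_mul_exp_neg_two_le h1
    have e : -(2 * (t * Z.sum)) = -(2 * (t / ε)) := by rw [hsum]; field_simp
    rw [e]; exact h2
  · refine (hH z Z' h).trans_eq (Finset.sum_congr rfl fun i hi => ?_)
    have hne : lam i + ε ≠ 0 := by
      intro h0
      have h1 := hlam i hi
      rw [show lam i = -ε by linarith, abs_neg, abs_of_pos hε] at h1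
      linarith
    field_simp
    ring

end Decay

end NewtonMR

namespace NewtonMR

open Polynomial

/-! ### Construction of the comparison polynomial. -/

section ResidualChain

theorem eval_prodOneSub_pos {Z : Multiset ℝ} {x : ℝ} (h : ∀ z ∈ Z, z * x < 1) :
    0 < (prodOneSub Z).eval x := by
  induction Z using Multiset.induction_on with
  | empty => simp [prodOneSub]
  | cons z Z ih =>
    rw [eval_prodOneSub_cons]
    exact mul_pos (by linarith [h z (Multiset.mem_cons_self z Z)])
      (ih fun a ha => h a (Multiset.mem_cons_of_mem ha))

theorem exists_mul_eq_one_of_eval_prodOneSub {Z : Multiset ℝ} {x : ℝ}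
    (h : (prodOneSub Z).eval x = 0) : ∃ z ∈ Z, z * x = 1 := by
  induction Z using Multiset.induction_on with
  | empty => simp [prodOneSub] at h
  | cons z Z ih =>
    rw [eval_prodOneSub_cons, mul_eq_zero] at h
    rcases h with h | h
    · exact ⟨z, Multiset.mem_cons_self z Z, by linarith⟩
    · obtain ⟨a, ha, ha'⟩ := ih h
      exact ⟨a, Multiset.mem_cons_of_mem ha, ha'⟩

theorem eval_prodOneSub_neg (Z : Multiset ℝ) (x : ℝ) :
    (prodOneSub (Z.map Neg.neg)).eval (-x) = (prodOneSub Z).eval x := by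
  induction Z using Multiset.induction_on with
  | empty => simp [prodOneSub]
  | cons z Z ih =>
    rw [Multiset.map_cons, eval_prodOneSub_cons, eval_prodOneSub_cons, ih, neg_mul_neg]

theorem eq_cons_map_neg {Z Z' : Multiset ℝ} {z : ℝ} (h : Z.map Neg.neg = z ::ₘ Z') :
    Z = -z ::ₘ Z'.map Neg.neg := by
  have := congrArg (Multiset.map (Neg.neg : ℝ → ℝ)) h
  simpa [Multiset.map_map] using this

/-- Each factor satisfies 0 ≤ 1 − zy ≤ exp(−zy), and exp(2/3) ≤ 2. This fixes the slope threshold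
2/(3ε) used below. -/
theorem eval_mem_Icc_of_slope {Z : Multiset ℝ} {ε y : ℝ} (hy : |y| ≤ ε)
    (hZ : ∀ z ∈ Z, |z| * ε ≤ 1) (hsum : |Z.sum| * ε ≤ 2 / 3) :
    0 ≤ (prodOneSub Z).eval y ∧ (prodOneSub Z).eval y ≤ 2 := by
  obtain ⟨h1, h2⟩ := eval_prodOneSub_bounds (Z := Z) (x := y) fun z hz => by
    refine (le_abs_self _).trans ?_
    rw [abs_mul]
    exact (mul_le_mul_of_nonneg_left hy (abs_nonneg z)).trans (hZ z hz)
  refine ⟨h1, h2.trans ?_⟩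
  have h3 : -(y * Z.sum) ≤ 2 / 3 := by
    refine (neg_le_abs _).trans ?_
    rw [abs_mul, mul_comm]
    exact (mul_le_mul_of_nonneg_left hy (abs_nonneg _)).trans hsum
  have h4 : -(y * Z.sum) ≤ Real.log 2 := by
    have := Real.log_two_gt_d9
    linarith
  calc Real.exp (-(y * Z.sum)) ≤ Real.exp (Real.log 2) := Real.exp_le_exp.mpr h4
    _ = 2 := Real.exp_log two_pos

variable {ι : Type*} {s : Finset ι} {w : ι → ℝ} {ε K : ℝ}

/-- The reflection x ↦ −x of nodes and roots exchanges the two signs of the slope. -/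
theorem sum_sq_le_of_abs_slope (hw : ∀ i ∈ s, 0 ≤ w i) (hε : 0 < ε) (hK : 3 * ε ≤ K)
    {lam : ι → ℝ} (hlam : ∀ i ∈ s, K ≤ |lam i|) {Z : Multiset ℝ} (hZ : ∀ z ∈ Z, |z| * K ≤ 1)
    (hsum : Z.sum = 2 / (3 * ε) ∨ Z.sum = -(2 / (3 * ε)))
    (hH : ∀ z Z', Z = z ::ₘ Z' → 0 ≤ ∑ i ∈ s, w i *
      (z * lam i * (1 - z * lam i) * (prodOneSub Z').eval (lam i) ^ 2)) :
    ∑ i ∈ s, w i * (prodOneSub Z).eval (lam i) ^ 2 ≤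
      3 * Real.exp 1 / (1 + K / ε) ^ 3 * ∑ i ∈ s, w i := by
  rcases hsum with hsum | hsum
  · exact sum_sq_le_of_slope hw hε hK hlam hZ hsum hH
  · have h := sum_sq_le_of_slope (lam := fun i => -lam i) (Z := Z.map Neg.neg) hw hε hK
      (fun i hi => by rw [abs_neg]; exact hlam i hi)
      (fun z hz => by
        obtain ⟨a, ha, rfl⟩ := Multiset.mem_map.mp hz
        rw [abs_neg]; exact hZ a ha)
      (by rw [Multiset.sum_map_neg', hsum, neg_neg])
      (fun z Z' h => by
        refine (hH _ _ (eq_cons_map_neg h)).trans_eq (Finset.sum_congr rfl fun i _ => ?_)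
        have e := eval_prodOneSub_neg (Z'.map Neg.neg) (lam i)
        rw [Multiset.map_map] at e
        simp only [neg_comp_neg, Multiset.map_id] at e
        rw [← e, neg_mul_comm])
    simpa only [eval_prodOneSub_neg] using h

theorem sum_sq_le_of_neg_root (hw : ∀ i ∈ s, 0 ≤ w i) (hε : 0 < ε) (hK : 3 * ε ≤ K)
    {lam : ι → ℝ} (hlam : ∀ i ∈ s, K ≤ |lam i|) {Z : Multiset ℝ} (hZ : ∀ z ∈ Z, |z| * K ≤ 1)
    (hsum : (-(1 / ε) ::ₘ Z).sum = 0)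
    (hH : ∀ z Z', Z = z ::ₘ Z' → ∑ i ∈ s, w i * (-(1 / ε) * lam i * (1 - -(1 / ε) * lam i) *
      (z * lam i * (1 - z * lam i)) * (prodOneSub Z').eval (lam i) ^ 2) ≤ 0) :
    ∑ i ∈ s, w i * (prodOneSub (-(1 / ε) ::ₘ Z)).eval (lam i) ^ 2 ≤
      3 * Real.exp 1 / (1 + K / ε) ^ 3 * ∑ i ∈ s, w i := by
  have h := sum_sq_le_of_root hw hε hK hlam hZ
    (by rw [Multiset.sum_cons] at hsum; linarith) (fun z Z' h => by
      have h1 := hH z Z' h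
      rw [← neg_nonneg, ← Finset.sum_neg_distrib] at h1
      refine h1.trans_eq (Finset.sum_congr rfl fun i _ => ?_)
      ring)
  refine le_trans (le_of_eq (Finset.sum_congr rfl fun i _ => ?_)) h
  rw [eval_prodOneSub_cons]
  ring

theorem sum_sq_le_of_gap_root (hw : ∀ i ∈ s, 0 ≤ w i) (hε : 0 < ε) (hK : 3 * ε ≤ K)
    {lam : ι → ℝ} (hlam : ∀ i ∈ s, K ≤ |lam i|) {Z : Multiset ℝ} (hZ : ∀ z ∈ Z, |z| * K ≤ 1)
    {z₀ : ℝ} (hz₀ : z₀ = -(1 / ε) ∨ z₀ = 1 / ε) (hsum : (z₀ ::ₘ Z).sum = 0)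
    (hH : ∀ z Z', Z = z ::ₘ Z' → ∑ i ∈ s, w i * (z₀ * lam i * (1 - z₀ * lam i) *
      (z * lam i * (1 - z * lam i)) * (prodOneSub Z').eval (lam i) ^ 2) ≤ 0) :
    ∑ i ∈ s, w i * (prodOneSub (z₀ ::ₘ Z)).eval (lam i) ^ 2 ≤
      3 * Real.exp 1 / (1 + K / ε) ^ 3 * ∑ i ∈ s, w i := by
  rcases hz₀ with rfl | rfl
  · exact sum_sq_le_of_neg_root hw hε hK hlam hZ hsum hH
  · have h := sum_sq_le_of_neg_root (lam := fun i => -lam i) (Z := Z.map Neg.neg) hw hε hK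
      (fun i hi => by rw [abs_neg]; exact hlam i hi)
      (fun z hz => by
        obtain ⟨a, ha, rfl⟩ := Multiset.mem_map.mp hz
        rw [abs_neg]; exact hZ a ha)
      (by
        rw [Multiset.sum_cons] at hsum ⊢
        rw [Multiset.sum_map_neg']; linarith)
      (fun z Z' h => by
        refine le_trans (le_of_eq (Finset.sum_congr rfl fun i _ => ?_)) (hH _ _ (eq_cons_map_neg h))
        have e := eval_prodOneSub_neg (Z'.map Neg.neg) (lam i)
        rw [Multiset.map_map] at e
        simp only [neg_comp_neg, Multiset.map_id] at e
        rw [← e]; ring)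
    rw [← Multiset.map_cons Neg.neg] at h
    simpa only [eval_prodOneSub_neg] using h

theorem exists_convex_comb_eq {a c t : ℝ} (h : (a ≤ t ∧ t < c) ∨ (c < t ∧ t ≤ a)) :
    ∃ b, 0 ≤ b ∧ b ≤ 1 ∧ (1 - b) * a + b * c = t := by
  have hne : c - a ≠ 0 := by rcases h with h | h <;> intro h' <;> linarith
  refine ⟨(t - a) / (c - a), ?_, ?_, by field_simp; ring⟩
  · rcases h with h | h
    · exact div_nonneg (by linarith) (by linarith)
    · exact div_nonneg_of_nonpos (by linarith) (by linarith)
  · rcases h with h | h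
    · exact (div_le_one (by linarith)).mpr (by linarith)
    · exact (div_le_one_of_neg (by linarith)).mpr (by linarith)

/-- For every degree there is a residual polynomial with values in `[0, 2]` on `[-ε, ε]` which is
either small or minimal on nodes outside the gap `(-K, K)`. -/
theorem exists_bounded_residual {lam : ι → ℝ} (hw : ∀ i ∈ s, 0 < w i) (hε : 0 < ε)
    (hK : 3 * ε ≤ K) (hlam : ∀ i ∈ s, K ≤ |lam i|) {j : ℕ} (hj : j = 1 ∨ j = 2) (n : ℕ) :
    (∃ P, IsResidual j n P ∧ (∀ y, |y| ≤ ε → 0 ≤ P.eval y ∧ P.eval y ≤ 2) ∧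
      ∑ i ∈ s, w i * P.eval (lam i) ^ 2 ≤ 3 * Real.exp 1 / (1 + K / ε) ^ 3 * ∑ i ∈ s, w i) ∨
    (∃ P, IsMinResidual s w lam j n P ∧ (∀ y, |y| ≤ ε → 0 ≤ P.eval y ∧ P.eval y ≤ 2) ∧
      |P.coeff 1| * ε ≤ 2 / 3) := by
  have hK0 : 0 < K := by linarith
  have hj1 : 1 ≤ j := by omega
  have hw' : ∀ i ∈ s, 0 ≤ w i := fun i hi => (hw i hi).le
  have hD : 0 ≤ 3 * Real.exp 1 / (1 + K / ε) ^ 3 * ∑ i ∈ s, w i := by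
    have := Finset.sum_nonneg hw'
    positivity
  induction n with
  | zero =>
    -- A multiple of X^j of degree below j is zero, so 1 is trivially minimal.
    refine Or.inr ⟨1, ⟨isResidual_one _ _, fun v hv => ?_⟩, fun y _ => by simp, by
      norm_num [coeff_one]⟩
    have h0 : v = 0 := by
      have h1 := hv.1
      rw [zero_add, degree_lt_iff_coeff_zero] at h1
      have h2 := X_pow_dvd_iff.mp hv.2
      ext m
      rcases lt_or_ge m j with h | h
      · exact h2 m h
      · exact h1 m h
    rw [h0, map_zero]
  | succ n ih =>
    rcases ih with ⟨P, hP, hb, hs⟩ | ⟨P₀, h₀, hb₀, hc₀⟩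
    · exact Or.inl ⟨P, hP.mono, hb, hs⟩
    -- If some residual polynomial vanishes at all nodes, so does the minimal P₀, and it is small.
    by_cases hNV : ∀ Q, IsResidual j n Q → ∃ i ∈ s, Q.eval (lam i) ≠ 0
    swap
    · push Not at hNV
      obtain ⟨Q, hQ, hQ0⟩ := hNV
      refine Or.inl ⟨P₀, h₀.1.mono, hb₀, le_trans (le_of_eq ?_) hD⟩
      have h1 := h₀.2 _ (h₀.1.sub_mem hQ)
      rw [map_sub, sub_eq_zero, discreteInner_apply, discreteInner_apply] at h1
      have h2 : ∑ i ∈ s, w i * P₀.eval (lam i) ^ 2 =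
          ∑ i ∈ s, w i * (P₀.eval (lam i) * P₀.eval (lam i)) :=
        Finset.sum_congr rfl fun i _ => by ring
      rw [h2, h1]
      exact Finset.sum_eq_zero fun i hi => by rw [hQ0 i hi]; ring
    obtain ⟨P₁, h₁⟩ := exists_isMinResidual lam hw' j (n + 1)
    have hstr : ∀ b : ℝ, 0 ≤ b → b ≤ 1 → _ := fun b hb hb' =>
      exists_reciprocal_roots hw hK0 hlam hj h₀ h₁ hb hb' hNV
    have hsmall : ∀ z : ℝ, |z| * K ≤ 1 → |z| * ε ≤ 1 := fun z hz => by
      have := mul_le_mul_of_nonneg_left (show ε ≤ K by linarith) (abs_nonneg z)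
      linarith
    have hP₁ : (1 - (1 : ℝ)) • P₀ + (1 : ℝ) • P₁ = P₁ := by simp
    rcases hj with rfl | rfl
    · by_cases hc₁ : |P₁.coeff 1| * ε ≤ 2 / 3
      · obtain ⟨Z, hZ, -, -, hZK⟩ := hstr 1 zero_le_one le_rfl
        rw [hP₁] at hZ
        refine Or.inr ⟨P₁, h₁, fun y hy => ?_, hc₁⟩
        rw [hZ]
        refine eval_mem_Icc_of_slope hy (fun z hz => hsmall z (hZK rfl z hz)) ?_
        rwa [hZ, (coeff_prodOneSub Z).2, abs_neg] at hc₁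
      · push Not at hc₁
        -- The slope crosses ±2/(3ε) between P₀ and P₁. Stopping there keeps the values in [0, 2]
        -- and forces decay.
        have key : ∃ c, (c = 2 / (3 * ε) ∨ c = -(2 / (3 * ε))) ∧
            ∃ b, 0 ≤ b ∧ b ≤ 1 ∧ (1 - b) * P₀.coeff 1 + b * P₁.coeff 1 = c := by
          have h1 : |P₀.coeff 1| ≤ 2 / (3 * ε) := by
            rw [le_div_iff₀ (by positivity)]; linarith
          have h2 : 2 / (3 * ε) < |P₁.coeff 1| := by
            rw [div_lt_iff₀ (by positivity)]; linarith
          obtain ⟨h3, h4⟩ := abs_le.mp h1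
          rcases lt_abs.mp h2 with h5 | h5
          · exact ⟨_, Or.inl rfl, exists_convex_comb_eq (Or.inl ⟨h4, h5⟩)⟩
          · exact ⟨_, Or.inr rfl, exists_convex_comb_eq (Or.inr ⟨by linarith, h3⟩)⟩
        obtain ⟨c, hc, b, hb0, hb1, hbc⟩ := key
        obtain ⟨Z, hZ, hZ0, -, hZK⟩ := hstr b hb0 hb1
        have hsum : Z.sum = -c := by
          have := congrArg (fun Q : ℝ[X] => Q.coeff 1) hZ
          simp only [coeff_add, coeff_smul, smul_eq_mul, (coeff_prodOneSub Z).2, hbc] at this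
          linarith
        refine Or.inl ⟨_, h₀.1.mono.convex h₁.1 b, fun y hy => ?_, ?_⟩
        · rw [hZ]
          refine eval_mem_Icc_of_slope hy (fun z hz => hsmall z (hZK rfl z hz)) ?_
          have : |Z.sum| = 2 / (3 * ε) := by
            rw [hsum, abs_neg]
            rcases hc with rfl | rfl
            · exact abs_of_pos (by positivity)
            · rw [abs_neg]; exact abs_of_pos (by positivity)
          rw [this]
          apply le_of_eq; field_simp
        · rw [hZ]
          refine sum_sq_le_of_abs_slope hw' hε hK hlam (hZK rfl) ?_ fun z Z' h => ?_
          · rw [hsum]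
            rcases hc with rfl | rfl
            · exact Or.inr rfl
            · exact Or.inl (neg_neg _)
          · subst h
            exact sum_mul_root_nonneg hw' h₀ h₁ hb0 hb1 (fun h => hZ0 (by simp [h])) hZ
    · have hcoeff : ∀ b : ℝ, ((1 - b) • P₀ + b • P₁).coeff 1 = 0 := fun b =>
        (h₀.1.mono.convex h₁.1 b).coeff_one
      have hothers : ∀ {Z : Multiset ℝ} {z : ℝ}, (0 : ℝ) ∉ z ::ₘ Z → 1 < |z| * K →
          (∀ a a' Z', z ::ₘ Z = a ::ₘ a' ::ₘ Z' → |a| * K ≤ 1 ∨ |a'| * K ≤ 1) →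
          ∀ a ∈ Z, |a| * K ≤ 1 := by
        intro Z z _ hz hpair a ha
        obtain ⟨Z', rfl⟩ := Multiset.exists_cons_of_mem ha
        exact (hpair z a Z' rfl).resolve_left hz.not_ge
      -- For j = 2 the slope is 0, so the only danger is a root in (−ε, ε). As at most one root lies
      -- in the gap, such a root makes the value at ε or −ε negative.
      by_cases hc₁ : 0 ≤ P₁.eval ε ∧ 0 ≤ P₁.eval (-ε)
      · obtain ⟨Z, hZ, hZ0, hpair, -⟩ := hstr 1 zero_le_one le_rfl
        have hc := hcoeff 1
        rw [hP₁] at hZ hc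
        refine Or.inr ⟨P₁, h₁, fun y hy => ?_, by rw [hc]; norm_num⟩
        rw [hZ]
        refine eval_mem_Icc_of_slope hy (fun z hz => ?_) ?_
        · by_contra! hcon
          obtain ⟨Z', rfl⟩ := Multiset.exists_cons_of_mem hz
          have hzK : 1 < |z| * K :=
            hcon.trans_le (mul_le_mul_of_nonneg_left (by linarith) (abs_nonneg z))
          have ho := hothers hZ0 hzK hpair
          have hneg : ∀ x, |x| = ε → 1 < z * x → (prodOneSub (z ::ₘ Z')).eval x < 0 := by
            intro x hx hzx
            rw [eval_prodOneSub_cons]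
            refine mul_neg_of_neg_of_pos (by linarith) (eval_prodOneSub_pos fun a ha => ?_)
            refine (le_abs_self _).trans_lt ?_
            rw [abs_mul, hx]
            have h1 := ho a ha
            have h2 := mul_le_mul_of_nonneg_left hK (abs_nonneg a)
            linarith
          rw [hZ] at hc₁
          rcases abs_cases z with ⟨h, -⟩ | ⟨h, -⟩
          · exact (hneg ε (abs_of_pos hε) (by rw [← h]; exact hcon)).not_ge hc₁.1
          · exact (hneg (-ε) (by rw [abs_neg, abs_of_pos hε]) (by
              rw [h] at hcon; linarith)).not_ge hc₁.2
        · rw [hZ, (coeff_prodOneSub Z).2, neg_eq_zero] at hc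
          rw [hc]; norm_num
      -- Stop the interpolation when a root sits exactly at ±ε. Zero slope then forces the other
      -- reciprocal roots to sum to −z₀, which provides the decay.
      · have key : ∃ x, (x = ε ∨ x = -ε) ∧
            ∃ b, 0 ≤ b ∧ b ≤ 1 ∧ (1 - b) * P₀.eval x + b * P₁.eval x = 0 := by
          have h1 := (hb₀ ε (abs_of_pos hε).le).1
          have h2 := (hb₀ (-ε) (by rw [abs_neg, abs_of_pos hε])).1
          rw [not_and_or, not_le, not_le] at hc₁
          rcases hc₁ with h | h
          · exact ⟨_, Or.inl rfl, exists_convex_comb_eq (Or.inr ⟨h, h1⟩)⟩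
          · exact ⟨_, Or.inr rfl, exists_convex_comb_eq (Or.inr ⟨h, h2⟩)⟩
        obtain ⟨x, hx, b, hb0, hb1, hbx⟩ := key
        obtain ⟨Z, hZ, hZ0, hpair, -⟩ := hstr b hb0 hb1
        have hroot : (prodOneSub Z).eval x = 0 := by
          rw [← hZ]; simpa using hbx
        obtain ⟨z₀, hz₀, hz₀x⟩ := exists_mul_eq_one_of_eval_prodOneSub hroot
        obtain ⟨Z', rfl⟩ := Multiset.exists_cons_of_mem hz₀
        have hz₀' : z₀ = -(1 / ε) ∨ z₀ = 1 / ε := by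
          rcases hx with rfl | rfl
          · exact Or.inr (by field_simp; linarith)
          · exact Or.inl (by field_simp; linarith)
        have habs : |z₀| = 1 / ε := by
          rcases hz₀' with rfl | rfl
          · rw [abs_neg]; exact abs_of_pos (by positivity)
          · exact abs_of_pos (by positivity)
        have hsum : (z₀ ::ₘ Z').sum = 0 := by
          have := hcoeff b
          rwa [hZ, (coeff_prodOneSub _).2, neg_eq_zero] at this
        have ho := hothers hZ0 (by
          rw [habs, div_mul_eq_mul_div, one_mul, lt_div_iff₀ hε]; linarith) hpair
        refine Or.inl ⟨_, h₀.1.mono.convex h₁.1 b, fun y hy => ?_, ?_⟩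
        · rw [hZ]
          refine eval_mem_Icc_of_slope hy (fun z hz => ?_) (by rw [hsum]; norm_num)
          rcases Multiset.mem_cons.mp hz with rfl | hz
          · rw [habs, one_div_mul_cancel hε.ne']
          · exact hsmall z (ho z hz)
        · rw [hZ]
          refine sum_sq_le_of_gap_root hw' hε hK hlam ho hz₀' hsum fun z Z'' h => ?_
          subst h
          exact sum_mul_roots_nonpos hw' h₀ h₁ hb0 hb1 (fun h => hZ0 (by simp [h]))
            (fun h => hZ0 (by simp [h])) hZ

end ResidualChain

/-! ### Comparison on the small nodes. -/

section SmallNodes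

variable {ι : Type*} [Fintype ι] {w lam : ι → ℝ} {ε K B : ℝ}

open Classical in
/-- On small nodes, a minimal residual polynomial stays close to `1` in the mean. -/
theorem sum_small_nodes_le (hw : ∀ i, 0 ≤ w i) (hε : 0 < ε) (hK : 3 * ε ≤ K)
    (hgap : ∀ i, |lam i| ≤ ε ∨ K ≤ |lam i|) {j n : ℕ} (hj : j = 1 ∨ j = 2) {r : ℝ[X]}
    (hr : IsMinResidual Finset.univ w lam j n r)
    (hB : (1 + K / ε) ^ 2 * ∑ i with |lam i| ≤ ε, w i ≤ 4 / 3 * ∑ i, w i) :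
    (1 + K / ε) ^ 2 * ∑ i with |lam i| ≤ ε, w i * (1 - r.eval (lam i)) ^ 2 ≤ 4 * ∑ i, w i := by
  set S : Finset ι := Finset.univ.filter fun i => |lam i| ≤ ε with hS
  set s : Finset ι := Finset.univ.filter fun i => ¬ |lam i| ≤ ε ∧ 0 < w i with hs
  have hk : 4 ≤ 1 + K / ε := by
    have : 3 ≤ K / ε := by rw [le_div_iff₀ hε]; exact hK
    linarith
  have hsplit : ∀ f : ι → ℝ, ∑ i, w i * f i = ∑ i ∈ S, w i * f i + ∑ i ∈ s, w i * f i := by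
    intro f
    rw [← Finset.sum_filter_add_sum_filter_not Finset.univ (fun i => |lam i| ≤ ε)]
    congr 1
    symm
    refine Finset.sum_subset (fun i hi => ?_) fun i hi hi' => ?_
    · simp only [hs, Finset.mem_filter] at hi ⊢; exact ⟨hi.1, hi.2.1⟩
    · simp only [hs, Finset.mem_filter, not_and, not_lt] at hi hi'
      rw [le_antisymm (hi' hi.1 hi.2) (hw i), zero_mul]
  have hws : ∀ i ∈ s, 0 < w i := fun i hi => (Finset.mem_filter.mp hi).2.2
  have hlam : ∀ i ∈ s, K ≤ |lam i| := fun i hi =>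
    (hgap i).resolve_left (Finset.mem_filter.mp hi).2.1
  have hsum : ∑ i ∈ s, w i ≤ ∑ i, w i :=
    Finset.sum_le_sum_of_subset_of_nonneg (Finset.subset_univ _) fun i _ _ => hw i
  have htot : 0 ≤ ∑ i, w i := Finset.sum_nonneg fun i _ => hw i
  -- Over all nodes r is orthogonal to r − P, so a lower bound for the sum of w r(r − P) over the
  -- large nodes is an upper bound over the small ones.
  have main : ∀ P : ℝ[X], IsResidual j n P → (∀ y, |y| ≤ ε → 0 ≤ P.eval y ∧ P.eval y ≤ 2) →
      -(2 / 3 * ∑ i, w i) ≤ (1 + K / ε) ^ 2 *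
        ∑ i ∈ s, w i * (r.eval (lam i) * (r.eval (lam i) - P.eval (lam i))) →
      (1 + K / ε) ^ 2 * ∑ i ∈ S, w i * (1 - r.eval (lam i)) ^ 2 ≤ 4 * ∑ i, w i := by
    intro P hP hb hl
    have h1 := hr.2 _ (hr.1.sub_mem hP)
    rw [discreteInner_apply] at h1
    simp only [eval_sub] at h1
    rw [hsplit] at h1
    have h2 : ∑ i ∈ S, w i * (1 - r.eval (lam i)) ^ 2 ≤ ∑ i ∈ S, (2 * w i +
        2 * (w i * (r.eval (lam i) * (r.eval (lam i) - P.eval (lam i))))) := by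
      refine Finset.sum_le_sum fun i hi => ?_
      obtain ⟨h3, h4⟩ := hb (lam i) (Finset.mem_filter.mp hi).2
      -- The sides differ by (1 + r − P)² + P(2 − P), which is why P must take values in [0, 2].
      have h5 : (1 - r.eval (lam i)) ^ 2 ≤
          2 + 2 * (r.eval (lam i) * (r.eval (lam i) - P.eval (lam i))) := by
        nlinarith [sq_nonneg (1 + r.eval (lam i) - P.eval (lam i)), mul_nonneg h3 (sub_nonneg.mpr h4)]
      have := mul_le_mul_of_nonneg_left h5 (hw i)
      linarith
    rw [Finset.sum_add_distrib, ← Finset.mul_sum, ← Finset.mul_sum] at h2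
    have h6 := mul_le_mul_of_nonneg_left h2 (sq_nonneg (1 + K / ε))
    have h7 : ∑ i ∈ S, w i * (r.eval (lam i) * (r.eval (lam i) - P.eval (lam i))) =
      -∑ i ∈ s, w i * (r.eval (lam i) * (r.eval (lam i) - P.eval (lam i))) := by linarith
    rw [h7] at h6
    linarith
  rcases exists_bounded_residual hws hε hK hlam hj n with ⟨P, hP, hb, hsm⟩ | ⟨P, hP, hb, -⟩
  · refine main P hP hb ?_
    -- Complete the square: r(r − P) = (r − P/2)² − P²/4.
    have h1 : -(1 / 4 * ∑ i ∈ s, w i * P.eval (lam i) ^ 2) ≤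
        ∑ i ∈ s, w i * (r.eval (lam i) * (r.eval (lam i) - P.eval (lam i))) := by
      rw [Finset.mul_sum, ← Finset.sum_neg_distrib]
      refine Finset.sum_le_sum fun i hi => ?_
      have := mul_nonneg (hw i) (sq_nonneg (r.eval (lam i) - P.eval (lam i) / 2))
      linarith
    have h2 : (1 + K / ε) ^ 2 * (3 * Real.exp 1 / (1 + K / ε) ^ 3 * ∑ i ∈ s, w i) ≤
        8 / 3 * ∑ i, w i := by
      have e : (1 + K / ε) ^ 2 * (3 * Real.exp 1 / (1 + K / ε) ^ 3 * ∑ i ∈ s, w i) =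
          3 * Real.exp 1 / (1 + K / ε) * ∑ i ∈ s, w i := by field_simp
      rw [e]
      refine mul_le_mul ?_ hsum (Finset.sum_nonneg fun i _ => hw i) (by norm_num)
      rw [div_le_iff₀ (by linarith)]
      have := Real.exp_one_lt_d9
      linarith
    have h3 := mul_le_mul_of_nonneg_left h1 (sq_nonneg (1 + K / ε))
    have h4 := mul_le_mul_of_nonneg_left hsm (sq_nonneg (1 + K / ε))
    linarith
  · refine main P hP.1 hb ?_
    have h1 := hP.2 _ (hr.1.sub_mem hP.1)
    rw [discreteInner_apply] at h1
    simp only [eval_sub] at h1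
    -- By minimality P is orthogonal to r − P on the large nodes, so this sum equals that of w(r −
    -- P)².
    have h2 : 0 ≤ ∑ i ∈ s, w i * (r.eval (lam i) * (r.eval (lam i) - P.eval (lam i))) := by
      have h3 : 0 ≤ ∑ i ∈ s, w i * (r.eval (lam i) - P.eval (lam i)) ^ 2 :=
        Finset.sum_nonneg fun i _ => mul_nonneg (hw i) (sq_nonneg _)
      have h4 : ∑ i ∈ s, w i * (r.eval (lam i) * (r.eval (lam i) - P.eval (lam i))) =
          ∑ i ∈ s, w i * (r.eval (lam i) - P.eval (lam i)) ^ 2 +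
          ∑ i ∈ s, w i * (P.eval (lam i) * (r.eval (lam i) - P.eval (lam i))) := by
        rw [← Finset.sum_add_distrib]
        exact Finset.sum_congr rfl fun i _ => by ring
      rw [h4, h1]; linarith
    have := mul_nonneg (sq_nonneg (1 + K / ε)) h2
    linarith

end SmallNodes

end NewtonMR

namespace NewtonMR

/-! ### Eigenvalues and small eigenspaces of the perturbed operator. -/

section Spectral

variable {E : Type*} [NormedAddCommGroup E] [InnerProductSpace ℝ E]
  {ι : Type*} [Fintype ι] (e : OrthonormalBasis ι ℝ E)

/-- The orthogonal projection onto the span of the basis vectors with index in `T`. -/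
noncomputable def partialSum (T : Finset ι) : E →ₗ[ℝ] E where
  toFun x := ∑ i ∈ T, ⟪e i, x⟫_ℝ • e i
  map_add' x y := by simp only [inner_add_right, add_smul, Finset.sum_add_distrib]
  map_smul' c x := by simp only [inner_smul_right, mul_smul, Finset.smul_sum, RingHom.id_apply]

open Classical in
theorem inner_partialSum (T : Finset ι) (i : ι) (x : E) :
    ⟪e i, partialSum e T x⟫_ℝ = if i ∈ T then ⟪e i, x⟫_ℝ else 0 := by
  change ⟪e i, ∑ k ∈ T, ⟪e k, x⟫_ℝ • e k⟫_ℝ = _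
  rw [inner_sum]
  simp only [inner_smul_right, orthonormal_iff_ite.mp e.orthonormal, mul_ite, mul_one, mul_zero,
    Finset.sum_ite_eq]

theorem eq_of_inner_basis_eq {x y : E} (h : ∀ i, ⟪e i, x⟫_ℝ = ⟪e i, y⟫_ℝ) : x = y := by
  refine e.repr.injective (PiLp.ext fun i => ?_)
  rw [e.repr_apply_apply, e.repr_apply_apply, h]

theorem inner_eq_sum_basis (x y : E) : ⟪x, y⟫_ℝ = ∑ i, ⟪e i, x⟫_ℝ * ⟪e i, y⟫_ℝ := by
  rw [← e.sum_inner_mul_inner x y]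
  simp only [real_inner_comm]

theorem norm_partialSum_sq (T : Finset ι) (x : E) :
    ‖partialSum e T x‖ ^ 2 = ∑ i ∈ T, ⟪e i, x⟫_ℝ ^ 2 := by
  classical
  rw [← e.sum_sq_inner_right]
  simp only [inner_partialSum]
  rw [← Finset.sum_subset (Finset.subset_univ T) (fun i _ hi => by simp [hi])]
  exact Finset.sum_congr rfl fun i hi => by rw [if_pos hi]

theorem inner_partialSum_comm (T : Finset ι) (x y : E) :
    ⟪partialSum e T x, y⟫_ℝ = ⟪x, partialSum e T y⟫_ℝ := by
  classical
  rw [inner_eq_sum_basis e, inner_eq_sum_basis e x]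
  refine Finset.sum_congr rfl fun i _ => ?_
  rw [inner_partialSum, inner_partialSum]
  split_ifs <;> simp

theorem norm_reflection_eq (T : Finset ι) (x : E) :
    ‖(2 : ℝ) • partialSum e T x - x‖ = ‖x‖ := by
  classical
  rw [← sq_eq_sq₀ (norm_nonneg _) (norm_nonneg _), ← e.sum_sq_inner_right, ← e.sum_sq_inner_right]
  refine Finset.sum_congr rfl fun i _ => ?_
  rw [inner_sub_right, inner_smul_right, inner_partialSum]
  split_ifs <;> ring

theorem norm_sub_partialSum_le (T : Finset ι) (x : E) : ‖x - partialSum e T x‖ ≤ ‖x‖ := by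
  classical
  rw [← sq_le_sq₀ (norm_nonneg _) (norm_nonneg _), ← e.sum_sq_inner_right, ← e.sum_sq_inner_right]
  refine Finset.sum_le_sum fun i _ => ?_
  rw [inner_sub_right, inner_partialSum]
  split_ifs
  · rw [sub_self, zero_pow two_ne_zero]; positivity
  · rw [sub_zero]

variable {e} {A : E →L[ℝ] E} {lam : ι → ℝ}

theorem partialSum_comm (hA : ∀ i x, ⟪e i, A x⟫_ℝ = lam i * ⟪e i, x⟫_ℝ) (T : Finset ι) (x : E) :
    partialSum e T (A x) = A (partialSum e T x) := by
  classical
  refine eq_of_inner_basis_eq e fun i => ?_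
  simp only [inner_partialSum, hA]
  split_ifs <;> simp

theorem norm_apply_le_of_eigenvalues (hA : ∀ i x, ⟪e i, A x⟫_ℝ = lam i * ⟪e i, x⟫_ℝ) {c : ℝ}
    (hc : 0 ≤ c) {x : E} (h : ∀ i, ⟪e i, x⟫_ℝ ≠ 0 → |lam i| ≤ c) : ‖A x‖ ≤ c * ‖x‖ := by
  rw [← sq_le_sq₀ (norm_nonneg _) (by positivity), mul_pow, ← e.sum_sq_inner_right,
    ← e.sum_sq_inner_right, Finset.mul_sum]
  refine Finset.sum_le_sum fun i _ => ?_
  rw [hA, mul_pow]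
  by_cases hx : ⟪e i, x⟫_ℝ = 0
  · simp [hx]
  · have := pow_le_pow_left₀ (abs_nonneg _) (h i hx) 2
    rw [sq_abs] at this
    exact mul_le_mul_of_nonneg_right this (sq_nonneg _)

theorem le_norm_apply_of_eigenvalues (hA : ∀ i x, ⟪e i, A x⟫_ℝ = lam i * ⟪e i, x⟫_ℝ) {c : ℝ}
    (hc : 0 ≤ c) {x : E} (h : ∀ i, ⟪e i, x⟫_ℝ ≠ 0 → c ≤ |lam i|) : c * ‖x‖ ≤ ‖A x‖ := by
  rw [← sq_le_sq₀ (by positivity) (norm_nonneg _), mul_pow, ← e.sum_sq_inner_right,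
    ← e.sum_sq_inner_right, Finset.mul_sum]
  refine Finset.sum_le_sum fun i _ => ?_
  rw [hA, mul_pow]
  by_cases hx : ⟪e i, x⟫_ℝ = 0
  · simp [hx]
  · have := pow_le_pow_left₀ hc (h i hx) 2
    rw [sq_abs] at this
    exact mul_le_mul_of_nonneg_right this (sq_nonneg _)

theorem finrank_span_basis (T : Finset ι) :
    Module.finrank ℝ (Submodule.span ℝ (e '' T)) = T.card := by
  have h1 : LinearIndependent ℝ fun i : T => e i :=
    e.orthonormal.linearIndependent.comp _ Subtype.val_injective
  have h2 := finrank_span_eq_card h1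
  rw [Fintype.card_coe] at h2
  rw [Set.image_eq_range]
  exact h2

theorem inner_eq_zero_of_mem_span {T : Finset ι} {x : E} (hx : x ∈ Submodule.span ℝ (e '' T))
    {i : ι} (hi : i ∉ T) : ⟪e i, x⟫_ℝ = 0 := by
  classical
  induction hx using Submodule.span_induction with
  | mem x hx =>
    obtain ⟨k, hk, rfl⟩ := hx
    rw [orthonormal_iff_ite.mp e.orthonormal, if_neg]
    rintro rfl
    exact hi hk
  | zero => exact inner_zero_right _
  | add x y _ _ hx hy => rw [inner_add_right, hx, hy, add_zero]
  | smul c x _ hx => rw [inner_smul_right, hx, mul_zero]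

variable [FiniteDimensional ℝ E] {H : E →L[ℝ] E} {ε γ : ℝ}

/-- On the span of eigenvectors with |λ| ≤ c one has ‖Hx‖ ≤ (c + ε)‖x‖ < γ‖x‖ for x ≠ 0, so it meets
the range of H only in 0. -/
theorem card_add_rank_le (hA : ∀ i x, ⟪e i, A x⟫_ℝ = lam i * ⟪e i, x⟫_ℝ)
    (hD : ∀ x, ‖A x - H x‖ ≤ ε * ‖x‖)
    (hH : ∀ x ∈ LinearMap.range H.toLinearMap, γ * ‖x‖ ≤ ‖H x‖) {c : ℝ} (hc₀ : 0 ≤ c)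
    (hc : c < γ - ε) :
    (Finset.univ.filter fun i => |lam i| ≤ c).card + rk H ≤ Module.finrank ℝ E := by
  rw [← finrank_span_basis (e := e)]
  refine Submodule.finrank_add_finrank_le_of_disjoint (Submodule.disjoint_def.mpr fun x hx hx' => ?_)
  by_contra hne
  have h1 := norm_apply_le_of_eigenvalues hA hc₀ (x := x) fun i hi => by
    by_contra h
    exact hi (inner_eq_zero_of_mem_span hx (by simpa using h))
  have h2 := hH x hx'
  have h3 : ‖H x‖ ≤ ‖A x‖ + ε * ‖x‖ := by
    have := norm_sub_le (A x) (A x - H x)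
    rw [sub_sub_cancel] at this
    linarith [hD x]
  have h4 : 0 < ‖x‖ := norm_pos_iff.mpr hne
  nlinarith

/-- At most dim ker H eigenvalues have modulus ≤ |λᵢ| and at most rank H have modulus ≥ |λᵢ| if |λᵢ|
lies strictly between ε and γ − ε. The two sets cover the basis and share i, a contradiction. -/
theorem eigenvalue_gap (hA : ∀ i x, ⟪e i, A x⟫_ℝ = lam i * ⟪e i, x⟫_ℝ)
    (hD : ∀ x, ‖A x - H x‖ ≤ ε * ‖x‖)
    (hH : ∀ x ∈ LinearMap.range H.toLinearMap, γ * ‖x‖ ≤ ‖H x‖) (i : ι) :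
    |lam i| ≤ ε ∨ γ - ε ≤ |lam i| := by
  classical
  by_contra! hcon
  have h1 := card_add_rank_le hA hD hH (abs_nonneg _) hcon.2
  have h2 : (Finset.univ.filter fun k => |lam i| ≤ |lam k|).card +
      Module.finrank ℝ (LinearMap.ker H.toLinearMap) ≤ Module.finrank ℝ E := by
    rw [← finrank_span_basis (e := e)]
    refine Submodule.finrank_add_finrank_le_of_disjoint
      (Submodule.disjoint_def.mpr fun x hx hx' => ?_)
    by_contra hne
    have h1 := le_norm_apply_of_eigenvalues hA (abs_nonneg (lam i)) (x := x) fun k hk => by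
      by_contra h
      exact hk (inner_eq_zero_of_mem_span hx (by simpa using h))
    have h2 := hD x
    rw [show H x = 0 from hx', sub_zero] at h2
    have h4 : 0 < ‖x‖ := norm_pos_iff.mpr hne
    nlinarith
  have h3 := LinearMap.finrank_range_add_finrank_ker H.toLinearMap
  have h4 : Module.finrank ℝ E = Fintype.card ι := Module.finrank_eq_card_basis e.toBasis
  have h5 := Finset.card_union_add_card_inter (Finset.univ.filter fun k => |lam k| ≤ |lam i|)
    (Finset.univ.filter fun k => |lam i| ≤ |lam k|)
  have h6 : (Finset.univ.filter fun k => |lam k| ≤ |lam i|) ∪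
      (Finset.univ.filter fun k => |lam i| ≤ |lam k|) = Finset.univ := by
    ext k; simpa using le_total _ _
  have h7 : 0 < ((Finset.univ.filter fun k => |lam k| ≤ |lam i|) ∩
      (Finset.univ.filter fun k => |lam i| ≤ |lam k|)).card :=
    Finset.card_pos.mpr ⟨i, by simp⟩
  rw [h6, Finset.card_univ] at h5
  unfold rk at h1
  omega

/-- The same count, with the nonzero eigenvalues as second set: there are at most rank A = rank H of
them. -/
theorem eigenvalue_gap_of_rk_eq (hA : ∀ i x, ⟪e i, A x⟫_ℝ = lam i * ⟪e i, x⟫_ℝ)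
    (hD : ∀ x, ‖A x - H x‖ ≤ ε * ‖x‖)
    (hH : ∀ x ∈ LinearMap.range H.toLinearMap, γ * ‖x‖ ≤ ‖H x‖) (hrk : rk A = rk H) (i : ι) :
    lam i = 0 ∨ γ - ε ≤ |lam i| := by
  classical
  by_contra! hcon
  have h1 := card_add_rank_le hA hD hH (abs_nonneg _) hcon.2
  have h2 : (Finset.univ.filter fun k => lam k ≠ 0).card ≤ rk A := by
    rw [← finrank_span_basis (e := e)]
    refine Submodule.finrank_mono (Submodule.span_le.mpr ?_)
    rintro _ ⟨k, hk, rfl⟩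
    have hk' : lam k ≠ 0 := by simpa using hk
    refine ⟨(lam k)⁻¹ • e k, ?_⟩
    refine eq_of_inner_basis_eq e fun m => ?_
    change ⟪e m, A _⟫_ℝ = _
    rw [hA, inner_smul_right, orthonormal_iff_ite.mp e.orthonormal]
    split_ifs with h
    · subst h; field_simp
    · simp
  have h4 : Module.finrank ℝ E = Fintype.card ι := Module.finrank_eq_card_basis e.toBasis
  have h5 := Finset.card_union_add_card_inter (Finset.univ.filter fun k => |lam k| ≤ |lam i|)
    (Finset.univ.filter fun k => lam k ≠ 0)
  have h6 : (Finset.univ.filter fun k => |lam k| ≤ |lam i|) ∪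
      (Finset.univ.filter fun k => lam k ≠ 0) = Finset.univ := by
    ext k
    simp only [Finset.mem_union, Finset.mem_filter, Finset.mem_univ, true_and, iff_true]
    by_cases h : lam k = 0
    · left; rw [h, abs_zero]; exact abs_nonneg _
    · exact Or.inr h
  have h7 : 0 < ((Finset.univ.filter fun k => |lam k| ≤ |lam i|) ∩
      (Finset.univ.filter fun k => lam k ≠ 0)).card :=
    Finset.card_pos.mpr ⟨i, by simpa using hcon.1⟩
  rw [h6, Finset.card_univ] at h5
  omega

/-- A vector in the range of `H` is almost orthogonal to the small eigenvalues of `A`. -/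
theorem norm_partialSum_le (hA : ∀ i x, ⟪e i, A x⟫_ℝ = lam i * ⟪e i, x⟫_ℝ)
    (hD : ∀ x, ‖A x - H x‖ ≤ ε * ‖x‖) (hHs : H.toLinearMap.IsSymmetric)
    (hH : ∀ x ∈ LinearMap.range H.toLinearMap, γ * ‖x‖ ≤ ‖H x‖) (hε : 0 < ε) (hεγ : 4 * ε ≤ γ)
    {T : Finset ι} (hT : ∀ i ∈ T, |lam i| ≤ ε) {g : E} (hg : g ∈ LinearMap.range H.toLinearMap) :
    3 * γ ^ 2 * ‖partialSum e T g‖ ^ 2 ≤ 4 * ε ^ 2 * ‖g‖ ^ 2 := by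
  classical
  set R := LinearMap.range H.toLinearMap with hR
  have hγ : 0 < γ := by linarith
  have hker : ∀ x, H (x - R.starProjection x) = 0 := by
    intro x
    have h : x - R.starProjection x ∈ Rᗮ := Submodule.sub_starProjection_mem_orthogonal x
    exact hHs.orthogonal_range.le h
  have hHU : ∀ x, γ * ‖R.starProjection x‖ ≤ ‖H x‖ := by
    intro x
    have h := hH _ (Submodule.starProjection_apply_mem R x)
    have h1 := hker x
    rw [map_sub, sub_eq_zero] at h1
    rwa [h1]
  set P := partialSum e T
  set y := P g with hy
  have h1 : γ * ‖R.starProjection y‖ ≤ 2 * ε * ‖y‖ := by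
    refine (hHU y).trans ?_
    have h2 : ‖A y‖ ≤ ε * ‖y‖ := norm_apply_le_of_eigenvalues hA hε.le fun i hi => by
      refine hT i ?_
      by_contra h
      exact hi (by rw [hy, inner_partialSum, if_neg h])
    have := norm_sub_le (A y) (A y - H y)
    rw [sub_sub_cancel] at this
    linarith [hD y]
  have h2 : ∀ k, H k = 0 → γ * ‖R.starProjection (P k)‖ ≤ ε * ‖k‖ := by
    intro k hk
    refine (hHU _).trans ?_
    -- With D = A − H and the isometry S = 2P − 1 commuting with A, one has 2HPk = SDk − DSk. This
    -- gives ε where a direct estimate gives 2ε.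
    have e1 : (2 : ℝ) • H (P k) = -(A ((2 : ℝ) • P k - k) - H ((2 : ℝ) • P k - k)) +
        ((2 : ℝ) • P (A k - H k) - (A k - H k)) := by
      rw [hk, sub_zero, partialSum_comm hA]
      simp only [map_sub, map_smul, hk]
      abel
    have e2 : ‖(2 : ℝ) • H (P k)‖ = 2 * ‖H (P k)‖ := by rw [norm_smul]; norm_num
    have h3 := norm_add_le (-(A ((2 : ℝ) • P k - k) - H ((2 : ℝ) • P k - k)))
        ((2 : ℝ) • P (A k - H k) - (A k - H k))
    rw [← e1, e2, norm_neg, norm_reflection_eq] at h3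
    have h4 := hD ((2 : ℝ) • P k - k)
    rw [norm_reflection_eq] at h4
    linarith [hD k]
  set v := y - R.starProjection y with hv
  have hvk : H v = 0 := hker y
  have horth : ⟪v, R.starProjection y⟫_ℝ = 0 := by
    refine Submodule.inner_left_of_mem_orthogonal (Submodule.starProjection_apply_mem R y) ?_
    exact Submodule.sub_starProjection_mem_orthogonal y
  have hyv : y = v + R.starProjection y := by rw [hv, sub_add_cancel]
  -- Duality: v is orthogonal to y − v, y = Pg, and g is fixed by the projection onto R, so both
  -- projections move onto v.
  have h3 : ‖v‖ ^ 2 = ⟪R.starProjection (P v), g⟫_ℝ := by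
    rw [Submodule.inner_starProjection_left_eq_right, Submodule.starProjection_eq_self_iff.mpr hg,
      inner_partialSum_comm, ← hy]
    conv_rhs => rw [hyv]
    rw [inner_add_right, horth, add_zero, real_inner_self_eq_norm_sq]
  have h4 : γ * ‖v‖ ≤ ε * ‖g‖ := by
    have h5 := real_inner_le_norm (R.starProjection (P v)) g
    rw [← h3] at h5
    have h6 := mul_le_mul_of_nonneg_right (h2 v hvk) (norm_nonneg g)
    have h7 := mul_le_mul_of_nonneg_left h5 hγ.le
    by_contra! hcon
    have hvpos : 0 < ‖v‖ := by
      by_contra! h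
      have : ‖v‖ = 0 := le_antisymm h (norm_nonneg v)
      rw [this] at hcon
      have := mul_nonneg hε.le (norm_nonneg g)
      linarith
    nlinarith
  have h5 : ‖y‖ ^ 2 = ‖v‖ ^ 2 + ‖R.starProjection y‖ ^ 2 := by
    conv_lhs => rw [hyv]
    rw [norm_add_sq_real, horth]; ring
  have h6 : ‖R.starProjection y‖ ≤ 1 / 2 * ‖y‖ := by
    have := norm_nonneg y
    have : γ * ‖R.starProjection y‖ ≤ γ * (1 / 2 * ‖y‖) := by nlinarith
    exact le_of_mul_le_mul_left this hγ
  have h7 := pow_le_pow_left₀ (norm_nonneg _) h6 2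
  have h8 := pow_le_pow_left₀ (by positivity) h4 2
  have h9 : 3 / 4 * ‖y‖ ^ 2 ≤ ‖v‖ ^ 2 := by linarith
  have h10 := mul_le_mul_of_nonneg_left h9 (sq_nonneg γ)
  linarith

end Spectral

/-! ### Krylov subspaces and least-squares residuals. -/

section Krylov

open Polynomial

variable {E : Type*} [NormedAddCommGroup E] [InnerProductSpace ℝ E]

theorem aeval_mem_krylov (A : E →L[ℝ] E) (b : E) {t : ℕ} {q : ℝ[X]} (hq : q.degree < t) :
    aeval A q b ∈ krylov A b t := by
  rw [aeval_eq_sum_range, _root_.sum_apply]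
  refine Submodule.sum_mem _ fun i _ => ?_
  rw [_root_.smul_apply]
  by_cases hi : i < t
  · exact Submodule.smul_mem _ _ (Submodule.subset_span ⟨i, hi, rfl⟩)
  · rw [degree_lt_iff_coeff_zero] at hq
    rw [hq i (by omega), zero_smul]
    exact Submodule.zero_mem _

theorem exists_aeval_of_mem_krylov {A : E →L[ℝ] E} {b p : E} {t : ℕ} (hp : p ∈ krylov A b t) :
    ∃ q : ℝ[X], q.degree < t ∧ p = aeval A q b := by
  induction hp using Submodule.span_induction with
  | mem x hx =>
    obtain ⟨i, hi, rfl⟩ := hx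
    exact ⟨X ^ i, by rw [degree_X_pow]; exact_mod_cast hi, by simp⟩
  | zero => exact ⟨0, by rw [degree_zero]; exact WithBot.bot_lt_coe _, by simp⟩
  | add x y _ _ hx hy =>
    obtain ⟨q, hq, rfl⟩ := hx
    obtain ⟨q', hq', rfl⟩ := hy
    exact ⟨q + q', (degree_add_le _ _).trans_lt (max_lt hq hq'), by simp⟩
  | smul c x _ hx =>
    obtain ⟨q, hq, rfl⟩ := hx
    exact ⟨c • q, (degree_smul_le _ _).trans_lt hq, by simp⟩

variable {ι : Type*} [Fintype ι] {e : OrthonormalBasis ι ℝ E} {A : E →L[ℝ] E} {lam : ι → ℝ}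

theorem inner_aeval (hA : ∀ i x, ⟪e i, A x⟫_ℝ = lam i * ⟪e i, x⟫_ℝ) (q : ℝ[X]) (i : ι) (x : E) :
    ⟪e i, aeval A q x⟫_ℝ = q.eval (lam i) * ⟪e i, x⟫_ℝ := by
  have hpow : ∀ n : ℕ, ∀ x, ⟪e i, (A ^ n) x⟫_ℝ = lam i ^ n * ⟪e i, x⟫_ℝ := by
    intro n
    induction n with
    | zero => simp
    | succ n ih =>
      intro x
      rw [pow_succ, _root_.mul_apply_eq_comp, ih, hA]; ring
  induction q using Polynomial.induction_on' with
  | add p q hp hq => rw [map_add, _root_.add_apply, inner_add_right, hp, hq, eval_add,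
      add_mul]
  | monomial n c =>
    rw [aeval_monomial, ← Algebra.smul_def, _root_.smul_apply, inner_smul_right, hpow,
      eval_monomial]
    ring

theorem IsLeastSquaresOn.inner_eq_zero {g p : E} {K : Submodule ℝ E}
    (h : IsLeastSquaresOn A g K p) {q : E} (hq : q ∈ K) : ⟪A p + g, A q⟫_ℝ = 0 := by
  by_contra hne
  set c := ⟪A p + g, A q⟫_ℝ
  set N := ‖A q‖ ^ 2
  have hN : 0 ≤ N := sq_nonneg _
  have h1 := h.2 (p + (-(c / (N + 1))) • q) (K.add_mem h.1 (K.smul_mem _ hq))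
  have h2 := pow_le_pow_left₀ (norm_nonneg _) h1 2
  have e1 : A (p + (-(c / (N + 1))) • q) + g = (A p + g) + (-(c / (N + 1))) • A q := by
    rw [map_add, map_smul]; abel
  rw [e1, norm_add_sq_real (A p + g), inner_smul_right, norm_smul, mul_pow, Real.norm_eq_abs, sq_abs] at h2
  have h3 : 0 ≤ 2 * (-(c / (N + 1)) * c) + (-(c / (N + 1))) ^ 2 * N := by linarith
  have e2 : 2 * (-(c / (N + 1)) * c) + (-(c / (N + 1))) ^ 2 * N =
      -(c ^ 2 * (N + 2) / (N + 1) ^ 2) := by field_simp; ring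
  rw [e2] at h3
  have : 0 < c ^ 2 * (N + 2) / (N + 1) ^ 2 := by positivity
  linarith

theorem IsLeastSquaresOn.norm_apply_le {g p : E} {K : Submodule ℝ E}
    (h : IsLeastSquaresOn A g K p) : ‖A p‖ ≤ ‖g‖ := by
  have h1 := h.inner_eq_zero h.1
  rw [inner_add_left, real_inner_self_eq_norm_sq] at h1
  have h2 := neg_le_of_abs_le (abs_real_inner_le_norm g (A p))
  nlinarith [norm_nonneg (A p), norm_nonneg g]

theorem IsLeastSquaresOn.norm_residual_sq {g p : E} {K : Submodule ℝ E}
    (h : IsLeastSquaresOn A g K p) : ‖A p + g‖ ^ 2 = ‖g‖ ^ 2 + ⟪A p, g⟫_ℝ := by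
  have h1 := h.inner_eq_zero h.1
  rw [inner_add_left, real_inner_self_eq_norm_sq] at h1
  have h2 := real_inner_comm (A p) g
  rw [norm_add_sq_real]
  linarith

/-- The residual polynomial of a least squares solution over a Krylov subspace is minimal. -/
theorem IsLeastSquaresOn.exists_isMinResidual
    (hA : ∀ i x, ⟪e i, A x⟫_ℝ = lam i * ⟪e i, x⟫_ℝ) {g p : E} {K : Submodule ℝ E}
    (h : IsLeastSquaresOn A g K p) {t : ℕ} (hK : K = krylov A g t ∨ K = krylov A (A g) t) :
    ∃ j, (j = 1 ∨ j = 2) ∧ ∃ r : ℝ[X],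
      IsMinResidual Finset.univ (fun i => ⟪e i, g⟫_ℝ ^ 2) lam j t r ∧
      ∀ i, ⟪e i, A p⟫_ℝ = (r.eval (lam i) - 1) * ⟪e i, g⟫_ℝ := by
  -- Starting vector g corresponds to j = 1 and Ag to j = 2; either way the residual polynomial is 1
  -- + X^j q.
  obtain ⟨j, hj, b, rfl, hb⟩ : ∃ j, (j = 1 ∨ j = 2) ∧ ∃ b, K = krylov A b t ∧
      ∀ i, lam i * ⟪e i, b⟫_ℝ = lam i ^ j * ⟪e i, g⟫_ℝ := by
    rcases hK with rfl | rfl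
    · exact ⟨1, Or.inl rfl, g, rfl, fun i => by rw [pow_one]⟩
    · exact ⟨2, Or.inr rfl, A g, rfl, fun i => by rw [hA]; ring⟩
  obtain ⟨q, hq, hp⟩ := exists_aeval_of_mem_krylov h.1
  have hcoord : ∀ i (q : ℝ[X]), ⟪e i, A (aeval A q b)⟫_ℝ =
      (X ^ j * q).eval (lam i) * ⟪e i, g⟫_ℝ := by
    intro i q
    rw [hA, inner_aeval hA, mul_left_comm, hb, eval_mul, eval_pow, eval_X]; ring
  have hApc : ∀ i, ⟪e i, A p⟫_ℝ = ((1 + X ^ j * q).eval (lam i) - 1) * ⟪e i, g⟫_ℝ := by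
    intro i
    rw [hp, hcoord, eval_add, eval_one]; ring
  refine ⟨j, hj, 1 + X ^ j * q, ⟨⟨?_, ?_⟩, fun v hv => ?_⟩, hApc⟩
  · rw [add_sub_cancel_left, mul_comm, degree_mul, degree_X_pow, Nat.cast_add]
    exact WithBot.add_lt_add_right (WithBot.coe_ne_bot) hq
  · rw [add_sub_cancel_left]; exact dvd_mul_right _ _
  · obtain ⟨hdeg, q', rfl⟩ := hv
    have hq' : q'.degree < t := by
      rw [degree_lt_iff_coeff_zero] at hdeg ⊢
      intro m hm
      have := hdeg (m + j) (by omega)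
      rwa [coeff_X_pow_mul] at this
    have h1 := h.inner_eq_zero (aeval_mem_krylov A b hq')
    rw [inner_eq_sum_basis e] at h1
    rw [discreteInner_apply, ← h1]
    refine Finset.sum_congr rfl fun i _ => ?_
    rw [hcoord, inner_add_right, hApc]; ring

theorem IsInexactDirection.exists_krylov {g p : E} {θ : ℝ} (hp : IsInexactDirection A g θ p) :
    ∃ (K : Submodule ℝ E) (t : ℕ), IsLeastSquaresOn A g K p ∧
      (K = krylov A g t ∨ K = krylov A (A g) t) := by
  obtain ⟨-, -, t, K, ⟨-, -, hK⟩, hls, -⟩ := hp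
  exact ⟨K, t, hls, hK.imp And.right id⟩

/-- By the normal equations ‖Ap + g‖² = ‖g‖² + ⟨p, Ag⟩, and the descent condition bounds the inner
product. -/
theorem IsInexactDirection.norm_residual_le {g p : E} {θ : ℝ} (hA : A.toLinearMap.IsSymmetric)
    (hp : IsInexactDirection A g θ p) : ‖A p + g‖ ≤ √θ * ‖g‖ := by
  obtain ⟨K, t, hls, -⟩ := hp.exists_krylov
  have h1 := hls.norm_residual_sq
  have h2 : ⟪A p, g⟫_ℝ = ⟪p, A g⟫_ℝ := hA p g
  have h3 := hp.2.1
  have h4 : ‖A p + g‖ ^ 2 ≤ θ * ‖g‖ ^ 2 := by rw [h1, h2]; linarith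
  rw [← Real.sqrt_sq (norm_nonneg (A p + g)), ← Real.sqrt_sq (norm_nonneg g)]
  rw [← Real.sqrt_mul' _ (sq_nonneg _)]
  exact Real.sqrt_le_sqrt h4

end Krylov

/-! ### Length of the inexact direction. -/

section Direction

variable {E : Type*} [NormedAddCommGroup E] [InnerProductSpace ℝ E] [FiniteDimensional ℝ E]
  {A H : E →L[ℝ] E} {ε γ C θ : ℝ} {g p : E}

theorem exists_eigenbasis (hA : A.toLinearMap.IsSymmetric) :
    ∃ (e : OrthonormalBasis (Fin (Module.finrank ℝ E)) ℝ E) (lam : Fin (Module.finrank ℝ E) → ℝ),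
      ∀ i x, ⟪e i, A x⟫_ℝ = lam i * ⟪e i, x⟫_ℝ := by
  refine ⟨hA.eigenvectorBasis rfl, hA.eigenvalues rfl, fun i x => ?_⟩
  have h1 := hA (hA.eigenvectorBasis rfl i) x
  have h2 := hA.apply_eigenvectorBasis rfl i
  rw [h2, inner_smul_left] at h1
  exact h1.symm

theorem pinv_apply_of_mem_range (hA : A.toLinearMap.IsSymmetric) {x : E}
    (hx : x ∈ LinearMap.range A.toLinearMap) : pinv A (A x) = x := by
  rw [pinv_apply]
  refine Submodule.starProjection_eq_self_iff.mpr ?_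
  obtain ⟨z, rfl⟩ := hx
  rw [Submodule.mem_orthogonal]
  intro k hk
  have h := hA k z
  rw [LinearMap.mem_ker.mp hk, inner_zero_left] at h
  exact h.symm

theorem IsInexactDirection.norm_le_of_rk_eq (hA : A.toLinearMap.IsSymmetric)
    (hD : ∀ x, ‖A x - H x‖ ≤ ε * ‖x‖)
    (hH : ∀ x ∈ LinearMap.range H.toLinearMap, γ * ‖x‖ ≤ ‖H x‖) (hεγ : ε < γ) (hrk : rk A = rk H)
    (hp : IsInexactDirection A g θ p) : (γ - ε) * ‖p‖ ≤ ‖g‖ := by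
  obtain ⟨K, t, hls, -⟩ := hp.exists_krylov
  obtain ⟨e, lam, he⟩ := exists_eigenbasis hA
  refine le_trans (le_norm_apply_of_eigenvalues he (by linarith) fun i hi => ?_) hls.norm_apply_le
  refine (eigenvalue_gap_of_rk_eq he hD hH hrk i).resolve_left fun h0 => hi ?_
  obtain ⟨z, rfl⟩ := hp.1
  exact (he i z).trans (by rw [h0, zero_mul])

/-- Large eigenvalues contribute ‖g‖/(γ − ε). On the small ones p is recovered from Ap by `pinv A`,
and the loss C/ε is offset by the factor 2ε/γ from `sum_small_nodes_le`, applied with gap K = γ − ε.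
-/
theorem IsInexactDirection.norm_le (hA : A.toLinearMap.IsSymmetric)
    (hHs : H.toLinearMap.IsSymmetric) (hD : ∀ x, ‖A x - H x‖ ≤ ε * ‖x‖)
    (hH : ∀ x ∈ LinearMap.range H.toLinearMap, γ * ‖x‖ ≤ ‖H x‖) (hε : 0 < ε) (hεγ : 4 * ε ≤ γ)
    (hC : 0 ≤ C) (hpinv : ‖pinv A‖ ≤ C / ε) (hg : g ∈ LinearMap.range H.toLinearMap)
    (hp : IsInexactDirection A g θ p) : ‖p‖ ≤ (1 / (γ - ε) + 2 * C / γ) * ‖g‖ := by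
  classical
  have hγ : 0 < γ := by linarith
  obtain ⟨K, t, hls, hK⟩ := hp.exists_krylov
  obtain ⟨e, lam, he⟩ := exists_eigenbasis hA
  have hgap := eigenvalue_gap he hD hH
  obtain ⟨j, hj, r, hr, hrp⟩ := hls.exists_isMinResidual he hK
  set T : Finset (Fin (Module.finrank ℝ E)) := Finset.univ.filter fun i => |lam i| ≤ ε with hT
  have hsq : 1 + (γ - ε) / ε = γ / ε := by field_simp; ring
  have hsmall := norm_partialSum_le he hD hHs hH hε hεγ (T := T)
    (fun i hi => (Finset.mem_filter.mp hi).2) hg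
  have hmain := sum_small_nodes_le (fun i => sq_nonneg _) hε (K := γ - ε) (by linarith) hgap hj hr
    (by
      rw [e.sum_sq_inner_right, hsq, ← norm_partialSum_sq, div_pow, div_mul_eq_mul_div,
        div_le_iff₀ (by positivity)]
      linarith)
  have hPA : ‖partialSum e T (A p)‖ ^ 2 =
      ∑ i ∈ T, ⟪e i, g⟫_ℝ ^ 2 * (1 - r.eval (lam i)) ^ 2 := by
    rw [norm_partialSum_sq]
    refine Finset.sum_congr rfl fun i _ => ?_
    rw [hrp]; ring
  rw [e.sum_sq_inner_right, hsq] at hmain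
  have hPA2 : ‖partialSum e T (A p)‖ ≤ 2 * ε / γ * ‖g‖ := by
    rw [← sq_le_sq₀ (norm_nonneg _) (by positivity), hPA]
    have e1 : (2 * ε / γ * ‖g‖) ^ 2 = (4 * ‖g‖ ^ 2) / (γ / ε) ^ 2 := by field_simp; ring
    rw [e1, le_div_iff₀ (by positivity), mul_comm]
    convert hmain using 3
  have hp2 : ‖partialSum e T p‖ ≤ 2 * C / γ * ‖g‖ := by
    have hmem : partialSum e T p ∈ LinearMap.range A.toLinearMap := by
      obtain ⟨z, rfl⟩ := hp.1
      exact ⟨partialSum e T z, (partialSum_comm he T z).symm⟩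
    rw [← pinv_apply_of_mem_range hA hmem, ← partialSum_comm he]
    refine (ContinuousLinearMap.le_opNorm _ _).trans ?_
    calc ‖pinv A‖ * ‖partialSum e T (A p)‖ ≤ C / ε * (2 * ε / γ * ‖g‖) :=
          mul_le_mul hpinv hPA2 (norm_nonneg _) (by positivity)
      _ = 2 * C / γ * ‖g‖ := by field_simp
  have hp1 : ‖p - partialSum e T p‖ ≤ 1 / (γ - ε) * ‖g‖ := by
    have h1 : (γ - ε) * ‖p - partialSum e T p‖ ≤ ‖A (p - partialSum e T p)‖ := by
      refine le_norm_apply_of_eigenvalues he (by linarith) fun i hi => ?_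
      refine (hgap i).resolve_left fun h => hi ?_
      rw [inner_sub_right, inner_partialSum, if_pos (by simpa [hT] using h), sub_self]
    rw [map_sub, ← partialSum_comm he] at h1
    have h2 := (norm_sub_partialSum_le e T (A p)).trans hls.norm_apply_le
    rw [div_mul_eq_mul_div, one_mul, le_div_iff₀ (by linarith)]
    linarith
  have h := norm_add_le (p - partialSum e T p) (partialSum e T p)
  rw [sub_add_cancel] at h
  linarith

end Direction

end NewtonMR

namespace NewtonMR

open Filter Topology

/-! ### Constancy of the Hessian's kernel; the gradient lies in the range. -/

section ConstantKernel

variable {E : Type*} [NormedAddCommGroup E] [InnerProductSpace ℝ E]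
  {g : E → E} {H : E → E →L[ℝ] E} {L γ : ℝ}

theorem norm_sub_sub_le_of_lipschitz_deriv (hg : ∀ x, HasFDerivAt g (H x) x)
    (hL : ∀ x y, ‖H x - H y‖ ≤ L * ‖x - y‖) (x v : E) :
    ‖g (x + v) - g x - H x v‖ ≤ L / 2 * ‖v‖ ^ 2 := by
  have hd : ∀ t : ℝ, HasDerivAt (fun t : ℝ => g (x + t • v) - g x - t • H x v)
      (H (x + t • v) v - H x v) t := by
    intro t
    have h1 : HasDerivAt (fun t : ℝ => x + t • v) v t := by
      simpa using ((hasDerivAt_id t).smul_const v).const_add x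
    have h2 := (hg (x + t • v)).comp_hasDerivAt t h1
    have h3 : HasDerivAt (fun t : ℝ => t • H x v) (H x v) t := by
      simpa using (hasDerivAt_id t).smul_const (H x v)
    exact (h2.sub_const (g x)).sub h3
  have h := image_norm_le_of_norm_deriv_right_le_deriv_boundary (a := 0) (b := 1)
    (B := fun t => L / 2 * ‖v‖ ^ 2 * t ^ 2) (B' := fun t => L * ‖v‖ ^ 2 * t)
    (fun t _ => (hd t).continuousAt.continuousWithinAt)
    (fun t _ => (hd t).hasDerivWithinAt) (by simp)
    (fun t => by
      have := ((hasDerivAt_pow 2 t).const_mul (L / 2 * ‖v‖ ^ 2))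
      exact this.congr_deriv (by norm_num; ring))
    (fun t ht => by
      rw [← _root_.sub_apply]
      refine (ContinuousLinearMap.le_opNorm _ _).trans ?_
      have h1 := hL (x + t • v) x
      rw [add_sub_cancel_left, norm_smul, Real.norm_eq_abs, abs_of_nonneg ht.1] at h1
      have := mul_le_mul_of_nonneg_right h1 (norm_nonneg v)
      linarith) (Set.right_mem_Icc.mpr zero_le_one)
  simpa using h

variable [FiniteDimensional ℝ E]

/-- Split a vector along the kernel and the range of a symmetric operator. -/
theorem exists_ker_add_range {A : E →L[ℝ] E} (hA : A.toLinearMap.IsSymmetric)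
    (hgap : ∀ p ∈ LinearMap.range A.toLinearMap, γ * ‖p‖ ≤ ‖A p‖) (n : E) :
    ∃ k m, n = k + m ∧ A k = 0 ∧ m ∈ LinearMap.range A.toLinearMap ∧ A m = A n ∧
      ‖k‖ ≤ ‖n‖ ∧ γ * ‖m‖ ≤ ‖A n‖ := by
  set R := LinearMap.range A.toLinearMap
  have h1 : n - R.starProjection n ∈ Rᗮ := Submodule.sub_starProjection_mem_orthogonal n
  have h2 : A (n - R.starProjection n) = 0 := hA.orthogonal_range.le h1
  have h3 : A (R.starProjection n) = A n := by
    rw [map_sub, sub_eq_zero] at h2; exact h2.symm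
  refine ⟨n - R.starProjection n, R.starProjection n, (sub_add_cancel _ _).symm, h2,
    Submodule.starProjection_apply_mem R n, h3, ?_, ?_⟩
  · rw [← Submodule.starProjection_orthogonal_val]
    exact Submodule.norm_starProjection_apply_le _ _
  · rw [← h3]; exact hgap _ (Submodule.starProjection_apply_mem R n)

/-- Only the range component m of n contributes to ⟨An, n⟩, and ‖m‖ ≤ ‖An‖/γ; as An = (A − B)n, the
form is quadratically small in A − B. -/
theorem abs_inner_apply_self_le (hγ : 0 < γ) {A B : E →L[ℝ] E} (hA : A.toLinearMap.IsSymmetric)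
    (hgap : ∀ p ∈ LinearMap.range A.toLinearMap, γ * ‖p‖ ≤ ‖A p‖) {n : E} (hn : B n = 0) :
    |⟪A n, n⟫_ℝ| ≤ ‖A - B‖ ^ 2 * ‖n‖ ^ 2 / γ := by
  obtain ⟨k, m, hnk, hk, -, hm, -, hm'⟩ := exists_ker_add_range hA hgap n
  have h1 : ‖A n‖ ≤ ‖A - B‖ * ‖n‖ := by
    have := (A - B).le_opNorm n
    rwa [_root_.sub_apply, hn, sub_zero] at this
  have h2 : ⟪A n, n⟫_ℝ = ⟪A n, m⟫_ℝ := by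
    conv_lhs => rw [hnk, inner_add_right, ← hnk]
    have : ⟪A n, k⟫_ℝ = ⟪n, A k⟫_ℝ := hA n k
    rw [this, hk, inner_zero_right, zero_add]
  rw [h2, le_div_iff₀ hγ]
  have h3 := abs_real_inner_le_norm (A n) m
  have h4 := mul_le_mul_of_nonneg_right h3 hγ.le
  have h5 := mul_le_mul_of_nonneg_left (hm'.trans h1) (norm_nonneg (A n))
  have h6 := mul_le_mul_of_nonneg_right h1 (mul_nonneg (norm_nonneg (A - B)) (norm_nonneg n))
  nlinarith

variable (hg : ∀ x, HasFDerivAt g (H x) x) (hs : ∀ x, (H x).toLinearMap.IsSymmetric)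
  (hL₀ : 0 ≤ L) (hL : ∀ x y, ‖H x - H y‖ ≤ L * ‖x - y‖) (hγ : 0 < γ)
  (hgap : ∀ x, ∀ p ∈ LinearMap.range (H x).toLinearMap, γ * ‖p‖ ≤ ‖H x p‖)

include hg hs hL₀ hL hγ hgap

/-- Compare ⟨g, v⟩ at the corners of the parallelogram with sides hv and ku, where u is the unit
vector along H(x+hv)v. Along v the increments are second-order small by `abs_inner_apply_self_le`;
along u they follow from Taylor's formula, the term at x vanishing because H(x)v = 0. -/
theorem mul_norm_hess_kernel_le {x v : E} (hv : H x v = 0) {h k : ℝ} (hh : 0 ≤ h) (hk : 0 ≤ k) :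
    k * ‖H (x + h • v) v‖ ≤
      2 * (h * (L ^ 2 * (h * ‖v‖ + k) ^ 2 * ‖v‖ ^ 2 / γ)) + L * k ^ 2 * ‖v‖ := by
  set Q := L ^ 2 * (h * ‖v‖ + k) ^ 2 * ‖v‖ ^ 2 / γ with hQ
  have hQ0 : 0 ≤ Q := by positivity
  obtain hz | hz := eq_or_ne (H (x + h • v) v) 0
  · rw [hz, norm_zero, mul_zero]; positivity
  set u : E := (‖H (x + h • v) v‖)⁻¹ • H (x + h • v) v with hu
  have hu1 : ‖u‖ = 1 := by
    rw [hu, norm_smul, norm_inv, norm_norm, inv_mul_cancel₀ (norm_ne_zero_iff.mpr hz)]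
  have huin : ⟪H (x + h • v) u, v⟫_ℝ = ‖H (x + h • v) v‖ := by
    have h1 : ⟪H (x + h • v) u, v⟫_ℝ = ⟪u, H (x + h • v) v⟫_ℝ := hs (x + h • v) u v
    rw [h1, hu, real_inner_smul_left, real_inner_self_eq_norm_sq]
    field_simp
  have hA : ∀ a, 0 ≤ a → a ≤ k →
      |⟪g (x + a • u + h • v) - g (x + a • u), v⟫_ℝ| ≤ h * Q := by
    intro a ha hak
    have hd : ∀ t : ℝ, HasDerivAt (fun t : ℝ => ⟪g (x + a • u + t • v), v⟫_ℝ)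
        ⟪H (x + a • u + t • v) v, v⟫_ℝ t := by
      intro t
      have h1 : HasDerivAt (fun t : ℝ => x + a • u + t • v) v t := by
        simpa using ((hasDerivAt_id t).smul_const v).const_add (x + a • u)
      have h2 := (hg (x + a • u + t • v)).comp_hasDerivAt t h1
      simpa using h2.inner ℝ (hasDerivAt_const t v)
    have h1 := norm_image_sub_le_of_norm_deriv_le_segment' (a := 0) (b := h) (C := Q)
      (fun t _ => (hd t).hasDerivWithinAt) (fun t ht => by
        refine (abs_inner_apply_self_le hγ (hs _) (hgap _) hv).trans ?_
        rw [hQ]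
        refine div_le_div_of_nonneg_right (mul_le_mul_of_nonneg_right ?_ (sq_nonneg _)) hγ.le
        rw [← mul_pow]
        refine pow_le_pow_left₀ (norm_nonneg _) ((hL _ _).trans ?_) 2
        refine mul_le_mul_of_nonneg_left ?_ hL₀
        have e : x + a • u + t • v - x = t • v + a • u := by abel
        rw [e]
        refine (norm_add_le _ _).trans ?_
        rw [norm_smul, norm_smul, hu1, Real.norm_eq_abs, Real.norm_eq_abs, abs_of_nonneg ht.1,
          abs_of_nonneg ha, mul_one]
        have := mul_le_mul_of_nonneg_right ht.2.le (norm_nonneg v)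
        linarith) h (Set.right_mem_Icc.mpr hh)
    rw [inner_sub_left]
    simpa [mul_comm] using h1
  have hA1 := hA k hk le_rfl
  have hA0 := hA 0 le_rfl hk
  rw [zero_smul, add_zero] at hA0
  have hB : ∀ y, |⟪g (y + k • u) - g y - H y (k • u), v⟫_ℝ| ≤ L / 2 * k ^ 2 * ‖v‖ := by
    intro y
    refine (abs_real_inner_le_norm _ _).trans (mul_le_mul_of_nonneg_right ?_ (norm_nonneg v))
    refine (norm_sub_sub_le_of_lipschitz_deriv hg hL y (k • u)).trans_eq ?_
    rw [norm_smul, hu1, mul_one, Real.norm_eq_abs, sq_abs]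
  have hB1 := hB (x + h • v)
  have hB0 := hB x
  have hx0 : ⟪H x u, v⟫_ℝ = 0 := by
    have h1 : ⟪H x u, v⟫_ℝ = ⟪u, H x v⟫_ℝ := hs x u v
    rw [h1, hv, inner_zero_right]
  have e : x + h • v + k • u = x + k • u + h • v := by abel
  rw [e] at hB1
  simp only [inner_sub_left, map_smul, real_inner_smul_left, huin, hx0] at hA1 hA0 hB1 hB0
  rw [abs_le] at hA1 hA0 hB1 hB0
  linarith [hA1.1, hA1.2, hA0.1, hA0.2, hB1.1, hB1.2, hB0.1, hB0.2]

/-- Split n = k + m along kernel and range. The part H(x+hk)k is o(h); replacing x+hk by x+hn, and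
evaluating at m, each cost Lh‖m‖‖n‖ at most, with ‖m‖ ≤ ‖H(x)n‖/γ. -/
theorem hess_kernel_slope_le {x n : E} {r : ℝ} (hr : 2 * L * ‖n‖ / γ * ‖H x n‖ < r) :
    ∀ᶠ h : ℝ in 𝓝[>] 0, h⁻¹ * (‖H (x + h • n) n‖ - ‖H x n‖) < r := by
  obtain ⟨k, m, hnk, hk, -, hm, hkn, hm'⟩ := exists_ker_add_range (hs x) (hgap x) n
  set φ := ‖H x n‖ with hφ
  set d := r - 2 * L * ‖n‖ / γ * φ with hd
  have hd0 : 0 < d := by linarith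
  -- The parallelogram has second side ηh, so its bound is h²c + hLη‖k‖; this η keeps the linear
  -- term below hd/2.
  set η := d / (2 * (L * ‖k‖ + 1)) with hη
  have hη0 : 0 < η := by positivity
  have hηd : L * η * ‖k‖ < d / 2 := by
    have : η * (L * ‖k‖ + 1) = d / 2 := by rw [hη]; field_simp
    nlinarith
  set c := 2 * (L ^ 2 * (‖k‖ + η) ^ 2 * ‖k‖ ^ 2 / γ) / η with hc
  have hlim : Tendsto (fun h : ℝ => h * c) (𝓝[>] 0) (𝓝 0) := by
    have : Tendsto (fun h : ℝ => h * c) (𝓝 0) (𝓝 (0 * c)) :=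
      (continuous_id.mul continuous_const).tendsto 0
    rw [zero_mul] at this
    exact this.mono_left nhdsWithin_le_nhds
  have hmγ : ‖m‖ ≤ φ / γ := by rw [le_div_iff₀ hγ]; linarith
  filter_upwards [hlim.eventually_lt_const (half_pos hd0), self_mem_nhdsWithin] with h hhc hh
  have hh0 : (0 : ℝ) < h := hh
  have h1 := mul_norm_hess_kernel_le hg hs hL₀ hL hγ hgap hk hh0.le (mul_nonneg hη0.le hh0.le)
  have h2 : ‖H (x + h • k) k‖ ≤ h * (h * c) + h * (L * η * ‖k‖) := by
    have e : 2 * (h * (L ^ 2 * (h * ‖k‖ + η * h) ^ 2 * ‖k‖ ^ 2 / γ)) + L * (η * h) ^ 2 * ‖k‖ =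
        η * h * (h * (h * c) + h * (L * η * ‖k‖)) := by rw [hc]; field_simp
    rw [e] at h1
    exact le_of_mul_le_mul_left h1 (by positivity)
  have h3 : ‖H (x + h • n) k‖ ≤ ‖H (x + h • k) k‖ + L * (h * ‖m‖) * ‖n‖ := by
    have h4 := (H (x + h • n) - H (x + h • k)).le_opNorm k
    have h5 := hL (x + h • n) (x + h • k)
    have e : x + h • n - (x + h • k) = h • m := by rw [hnk, smul_add]; abel
    rw [e, norm_smul, Real.norm_eq_abs, abs_of_pos hh0] at h5
    have h6 := norm_le_norm_add_norm_sub' (H (x + h • n) k) (H (x + h • k) k)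
    rw [_root_.sub_apply] at h4
    have h7 := mul_le_mul h5 hkn (norm_nonneg k) (by positivity)
    linarith
  have h8 : ‖H (x + h • n) m‖ ≤ φ + L * (h * ‖n‖) * ‖m‖ := by
    have h4 := (H (x + h • n) - H x).le_opNorm m
    have h5 := hL (x + h • n) x
    rw [add_sub_cancel_left, norm_smul, Real.norm_eq_abs, abs_of_pos hh0] at h5
    have h6 := norm_le_norm_add_norm_sub' (H (x + h • n) m) (H x m)
    rw [_root_.sub_apply] at h4
    rw [hm] at h4 h6
    have h7 := mul_le_mul_of_nonneg_right h5 (norm_nonneg m)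
    linarith
  have h9 : ‖H (x + h • n) n‖ ≤ ‖H (x + h • n) k‖ + ‖H (x + h • n) m‖ := by
    have e : H (x + h • n) n = H (x + h • n) k + H (x + h • n) m := by rw [← map_add, ← hnk]
    rw [e]
    exact norm_add_le _ _
  rw [inv_mul_lt_iff₀ hh0]
  have h10 : L * (h * ‖n‖) * ‖m‖ ≤ L * (h * ‖n‖) * (φ / γ) :=
    mul_le_mul_of_nonneg_left hmγ (by positivity)
  have h11 : h * r = h * (2 * L * ‖n‖ / γ * φ) + h * d := by rw [hd]; ring
  have h12 : 2 * (L * (h * ‖n‖) * (φ / γ)) = h * (2 * L * ‖n‖ / γ * φ) := by field_simp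
  have h13 : h * (h * c) + h * (L * η * ‖k‖) < h * d := by
    rw [← mul_add]
    exact mul_lt_mul_of_pos_left (by linarith) hh0
  linarith

/-- Grönwall's inequality along the segment, with zero initial value and the slope bound above. -/
theorem hess_apply_kernel_eq_zero {x n : E} (hn : H x n = 0) {s : ℝ} (hs' : s ∈ Set.Icc (0 : ℝ) 1) :
    H (x + s • n) n = 0 := by
  have hcont : Continuous H := by
    refine LipschitzWith.continuous (K := ⟨L, hL₀⟩) (LipschitzWith.of_dist_le_mul fun a b => ?_)
    rw [dist_eq_norm, dist_eq_norm]; exact hL a b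
  have hc : Continuous fun s : ℝ => ‖H (x + s • n) n‖ := by fun_prop
  have h := le_gronwallBound_of_liminf_deriv_right_le (f := fun s : ℝ => ‖H (x + s • n) n‖)
    (f' := fun s => 2 * L * ‖n‖ / γ * ‖H (x + s • n) n‖) (δ := 0) (K := 2 * L * ‖n‖ / γ) (ε := 0)
    (a := 0) (b := 1) hc.continuousOn (fun s _ r hr => ?_) (by simp [hn])
    (fun s _ => by simp) s hs'
  · rw [gronwallBound_ε0_δ0] at h
    exact norm_le_zero_iff.mp h
  · have h1 := hess_kernel_slope_le hg hs hL₀ hL hγ hgap hr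
    have h2 : ∀ᶠ z : ℝ in 𝓝[>] s, (z - s)⁻¹ * (‖H (x + s • n + (z - s) • n) n‖ -
        ‖H (x + s • n) n‖) < r := by
      have ht : Tendsto (fun z : ℝ => z - s) (𝓝[>] s) (𝓝[>] 0) := by
        refine tendsto_nhdsWithin_iff.mpr ⟨?_, ?_⟩
        · have : Tendsto (fun z : ℝ => z - s) (𝓝 s) (𝓝 (s - s)) :=
            (continuous_id.sub continuous_const).tendsto s
          rw [sub_self] at this
          exact this.mono_left nhdsWithin_le_nhds
        · filter_upwards [self_mem_nhdsWithin] with z hz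
          exact sub_pos.mpr (Set.mem_Ioi.mp hz)
      exact ht.eventually h1
    refine Eventually.frequently (h2.mono fun z hz => ?_)
    have e : x + s • n + (z - s) • n = x + z • n := by rw [sub_smul]; abel
    rwa [e] at hz

theorem grad_add_kernel {x n : E} (hn : H x n = 0) : g (x + n) = g x := by
  have hd : ∀ t : ℝ, HasDerivAt (fun t : ℝ => g (x + t • n)) (H (x + t • n) n) t := by
    intro t
    have h1 : HasDerivAt (fun t : ℝ => x + t • n) n t := by
      simpa using ((hasDerivAt_id t).smul_const n).const_add x
    exact (hg (x + t • n)).comp_hasDerivAt t h1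
  have h := norm_image_sub_le_of_norm_deriv_le_segment_01' (C := 0)
    (fun t _ => (hd t).hasDerivWithinAt) (fun t ht => by
      rw [hess_apply_kernel_eq_zero hg hs hL₀ hL hγ hgap hn ⟨ht.1, ht.2.le⟩, norm_zero])
  have := norm_le_zero_iff.mp h
  simpa [sub_eq_zero] using this

/-- The gradient is constant on x + ker H(x); differentiate it at x + n in the direction m. -/
theorem kernel_le_kernel_add {x n m : E} (hn : H x n = 0) (hm : H x m = 0) : H (x + n) m = 0 := by
  have h1 : HasDerivAt (fun t : ℝ => x + n + t • m) m 0 := by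
    simpa using ((hasDerivAt_id (0 : ℝ)).smul_const m).const_add (x + n)
  have h2 : HasDerivAt (fun t : ℝ => g (x + n + t • m)) (H (x + n) m) 0 := by
    have h3 : HasFDerivAt g (H (x + n)) (x + n + (0 : ℝ) • m) := by simpa using hg (x + n)
    exact h3.comp_hasDerivAt 0 h1
  have h4 : (fun t : ℝ => g (x + n + t • m)) = fun _ => g x := by
    funext t
    rw [add_assoc]
    exact grad_add_kernel hg hs hL₀ hL hγ hgap (by rw [map_add, map_smul, hn, hm]; simp)
  rw [h4] at h2
  exact h2.unique (hasDerivAt_const 0 (g x))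

theorem kernel_add_iff {x n m : E} (hn : H x n = 0) : H (x + n) m = 0 ↔ H x m = 0 := by
  refine ⟨fun h => ?_, kernel_le_kernel_add hg hs hL₀ hL hγ hgap hn⟩
  have h1 := kernel_le_kernel_add hg hs hL₀ hL hγ hgap hn (m := -n) (by rw [map_neg, hn, neg_zero])
  have h2 := kernel_le_kernel_add hg hs hL₀ hL hγ hgap h1 h
  rwa [add_neg_cancel_right] at h2

/-- Follow the line x + tn, on which g is constant, modulo ker H(y). Its range component q(t) starts
inside the ball of radius c and can never reach the sphere, so q is bounded; being affine, it is
constant, and n has no range component. -/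
theorem kernel_le_kernel_of_near {x y : E} (hxy : ‖x - y‖ < γ / (L + 1))
    (hgxy : ‖g x - g y‖ < γ * (γ / (L + 1)) / 2) {n : E} (hn : H x n = 0) : H y n = 0 := by
  set R := LinearMap.range (H y).toLinearMap with hR
  set c := γ / (L + 1) with hc
  have hc0 : 0 < c := by positivity
  have hcγ : (L + 1) * c = γ := by rw [hc]; field_simp
  let q : ℝ → E := fun t => R.starProjection (x - y + t • n)
  -- On the sphere, Taylor's formula at y + k, where g and the kernel agree with those at y, gives
  -- ‖g x − g y‖ ≥ γc − (L/2)c² ≥ γc/2.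
  have hq : ∀ t, ‖q t‖ ≠ c := by
    intro t htc
    have hgt : g (x + t • n) = g x :=
      grad_add_kernel hg hs hL₀ hL hγ hgap (by rw [map_smul, hn, smul_zero])
    have hk : H y (x - y + t • n - q t) = 0 :=
      (hs y).orthogonal_range.le (Submodule.sub_starProjection_mem_orthogonal _)
    set k := x - y + t • n - q t with hkdef
    have hgb : g (y + k) = g y := grad_add_kernel hg hs hL₀ hL hγ hgap hk
    have hqR : q t ∈ LinearMap.range (H (y + k)).toLinearMap := by
      have h1 : q t ∈ R := Submodule.starProjection_apply_mem R _
      rw [← Submodule.orthogonal_orthogonal (LinearMap.range (H (y + k)).toLinearMap),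
        (hs (y + k)).orthogonal_range, Submodule.mem_orthogonal]
      intro a ha
      have h2 : H y a = 0 := (kernel_add_iff hg hs hL₀ hL hγ hgap hk).mp ha
      obtain ⟨z, hz⟩ := h1
      have h3 : ⟪H y a, z⟫_ℝ = ⟪a, H y z⟫_ℝ := hs y a z
      rw [← hz]
      change ⟪a, H y z⟫_ℝ = 0
      rw [← h3, h2, inner_zero_left]
    have h1 := norm_sub_sub_le_of_lipschitz_deriv hg hL (y + k) (q t)
    have e : y + k + q t = x + t • n := by rw [hkdef]; abel
    rw [e, hgt, hgb] at h1
    have h2 := hgap _ _ hqR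
    have h3 := norm_sub_le (g x - g y) (g x - g y - H (y + k) (q t))
    rw [sub_sub_cancel] at h3
    rw [htc] at h1 h2
    nlinarith
  have hlt : ∀ t, ‖q t‖ < c := by
    intro t
    by_contra! h
    have h0 : ‖q 0‖ ≤ c := by
      have : ‖q 0‖ ≤ ‖x - y‖ := by
        have := Submodule.norm_starProjection_apply_le R (x - y + (0 : ℝ) • n)
        simpa [q] using this
      linarith
    have hcont : Continuous fun t => ‖q t‖ := by
      have : Continuous q := R.starProjection.continuous.comp (by fun_prop)
      exact this.norm
    obtain ⟨s, hs⟩ := mem_range_of_exists_le_of_exists_ge hcont ⟨0, h0⟩ ⟨t, h⟩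
    exact hq s hs
  have hz : R.starProjection n = 0 := by
    by_contra hne
    have hpos : 0 < ‖R.starProjection n‖ := norm_pos_iff.mpr hne
    have h1 := hlt (2 * c / ‖R.starProjection n‖)
    have h0 := hlt 0
    have e : (2 * c / ‖R.starProjection n‖) • R.starProjection n =
        q (2 * c / ‖R.starProjection n‖) - q 0 := by
      simp only [q, map_add, map_smul, zero_smul, add_zero]
      abel
    have h2 : ‖(2 * c / ‖R.starProjection n‖) • R.starProjection n‖ = 2 * c := by
      rw [norm_smul, Real.norm_eq_abs, abs_of_pos (by positivity)]
      field_simp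
    have h3 := norm_sub_le (q (2 * c / ‖R.starProjection n‖)) (q 0)
    rw [← e, h2] at h3
    linarith
  have h1 : H y (n - R.starProjection n) = 0 :=
    (hs y).orthogonal_range.le (Submodule.sub_starProjection_mem_orthogonal _)
  rwa [hz, sub_zero] at h1

/-- A Lipschitz Hessian whose nonzero eigenvalues are bounded away from zero has constant kernel. -/
theorem kernel_eq (x y : E) :
    LinearMap.ker (H x).toLinearMap = LinearMap.ker (H y).toLinearMap := by
  have hloc : IsLocallyConstant fun x => LinearMap.ker (H x).toLinearMap := by
    rw [IsLocallyConstant.iff_eventually_eq]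
    intro x
    have hcont : Continuous g := continuous_iff_continuousAt.mpr fun x => (hg x).continuousAt
    have h1 : Tendsto (fun y => ‖x - y‖) (𝓝 x) (𝓝 ‖x - x‖) :=
      (continuous_const.sub continuous_id).norm.tendsto x
    have h2 : Tendsto (fun y => ‖g x - g y‖) (𝓝 x) (𝓝 ‖g x - g x‖) :=
      (continuous_const.sub hcont).norm.tendsto x
    rw [sub_self, norm_zero] at h1 h2
    have hc : 0 < γ / (L + 1) := by positivity
    filter_upwards [h1.eventually_lt_const hc,
      h2.eventually_lt_const (half_pos (mul_pos hγ hc))] with y hy1 hy2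
    refine le_antisymm (fun n hn => ?_) fun n hn => ?_
    · exact kernel_le_kernel_of_near hg hs hL₀ hL hγ hgap (by rwa [norm_sub_rev])
        (by rwa [norm_sub_rev]) hn
    · exact kernel_le_kernel_of_near hg hs hL₀ hL hγ hgap hy1 hy2 hn
  exact hloc.apply_eq_of_preconnectedSpace x y

/-- A damped Newton step −αp with H(x)p equal to the range component of g(x), whose norm is s. Since
‖p‖ ≤ s/γ, the choice α·L·2m ≤ γ² bounds the Taylor error by αs/2, uniformly while s ≤ 2m. -/
theorem exists_newton_decrease {m : ℝ} (hm : 0 < m) : ∃ β < (1 : ℝ), 1 / 2 ≤ β ∧ ∀ x,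
    ‖(LinearMap.range (H x).toLinearMap).starProjection (g x)‖ ≤ 2 * m →
    ∃ y, ‖(LinearMap.range (H x).toLinearMap).starProjection (g y)‖ ≤
      β * ‖(LinearMap.range (H x).toLinearMap).starProjection (g x)‖ := by
  set α := γ ^ 2 / (2 * L * m + γ ^ 2) with hα
  have hα0 : 0 < α := by positivity
  have hα1 : α ≤ 1 := by
    rw [hα, div_le_one (by positivity)]
    have : 0 ≤ 2 * L * m := by positivity
    linarith
  have hαL : α * (L * (2 * m)) ≤ γ ^ 2 := by
    rw [hα, div_mul_eq_mul_div, div_le_iff₀ (by positivity)]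
    have : 0 ≤ γ ^ 2 * γ ^ 2 := by positivity
    linarith
  refine ⟨1 - α / 2, by linarith, by linarith, fun x hx => ?_⟩
  set R := LinearMap.range (H x).toLinearMap with hR
  set s := ‖R.starProjection (g x)‖ with hsdef
  obtain ⟨z, hz⟩ := Submodule.starProjection_apply_mem R (g x)
  obtain ⟨-, p, -, -, -, hp, -, hp'⟩ := exists_ker_add_range (hs x) (hgap x) z
  replace hz : H x z = R.starProjection (g x) := hz
  rw [hz] at hp hp'
  have hT := norm_sub_sub_le_of_lipschitz_deriv hg hL x (-α • p)
  refine ⟨x + -α • p, ?_⟩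
  have e : R.starProjection (g (x + -α • p)) =
      R.starProjection (g (x + -α • p) - g x - H x (-α • p)) +
        (1 - α) • R.starProjection (g x) := by
    have h1 : R.starProjection (H x (-α • p)) = -α • R.starProjection (g x) := by
      rw [map_smul, hp, map_smul]
      congr 1
      exact Submodule.starProjection_eq_self_iff.mpr (Submodule.starProjection_apply_mem R _)
    rw [map_sub, map_sub, h1]
    generalize R.starProjection (g (x + -α • p)) = w
    module
  rw [e]
  refine (norm_add_le _ _).trans ?_
  have h1 := (Submodule.norm_starProjection_apply_le R
    (g (x + -α • p) - g x - H x (-α • p))).trans hT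
  rw [norm_smul, Real.norm_eq_abs, abs_neg, abs_of_pos hα0] at h1
  have h2 : ‖(1 - α) • R.starProjection (g x)‖ = (1 - α) * s := by
    rw [norm_smul, Real.norm_eq_abs, abs_of_nonneg (by linarith)]
  have h3 : L / 2 * (α * ‖p‖) ^ 2 ≤ α / 2 * s := by
    have hs0 : 0 ≤ s := norm_nonneg _
    have h4 := pow_le_pow_left₀ (by positivity) hp' 2
    have h5 : α * (L * s) ≤ γ ^ 2 :=
      (mul_le_mul_of_nonneg_left (mul_le_mul_of_nonneg_left hx hL₀) hα0.le).trans hαL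
    have h6 : γ ^ 2 * (L / 2 * (α * ‖p‖) ^ 2) ≤ γ ^ 2 * (α / 2 * s) := by
      have h7 := mul_le_mul_of_nonneg_left h4 (show 0 ≤ L / 2 * α ^ 2 by positivity)
      have h8 := mul_le_mul_of_nonneg_left h5 (show 0 ≤ α / 2 * s by positivity)
      have h9 : (L / 2 * α ^ 2) * s ^ 2 = α / 2 * s * (α * (L * s)) := by ring
      linarith
    exact le_of_mul_le_mul_left h6 (by positivity)
  rw [h2]
  linarith

/-- Under the null-space property the gradient lies in the range of the Hessian. -/
theorem grad_mem_range {a : ℝ}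
    (hν : ∀ x, ‖(LinearMap.range (H x).toLinearMap)ᗮ.starProjection (g x)‖ ^ 2 ≤
      a * ‖(LinearMap.range (H x).toLinearMap).starProjection (g x)‖ ^ 2) (x₀ : E) :
    g x₀ ∈ LinearMap.range (H x₀).toLinearMap := by
  have hperp : ∀ x, (LinearMap.range (H x).toLinearMap)ᗮ =
      (LinearMap.range (H x₀).toLinearMap)ᗮ := fun x => by
    rw [(hs x).orthogonal_range, (hs x₀).orthogonal_range]
    exact kernel_eq hg hs hL₀ hL hγ hgap x x₀
  have hrange : ∀ x, LinearMap.range (H x).toLinearMap = LinearMap.range (H x₀).toLinearMap :=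
    fun x => by
      rw [← Submodule.orthogonal_orthogonal (LinearMap.range (H x).toLinearMap), hperp,
        Submodule.orthogonal_orthogonal]
  set R := LinearMap.range (H x₀).toLinearMap with hR
  have hν' : ∀ x, ‖Rᗮ.starProjection (g x)‖ ^ 2 ≤ a * ‖R.starProjection (g x)‖ ^ 2 := by
    intro x
    have := hν x
    simp only [hrange x] at this
    exact this
  -- All Hessians have range R, so the derivative of the component orthogonal to R vanishes.
  have hconst : ∀ x, Rᗮ.starProjection (g x) = Rᗮ.starProjection (g x₀) := by
    intro x
    have hd : ∀ y, HasFDerivAt (fun y => Rᗮ.starProjection (g y)) (0 : E →L[ℝ] E) y := by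
      intro y
      have h1 : HasFDerivAt (fun y => Rᗮ.starProjection (g y)) (Rᗮ.starProjection ∘L H y) y :=
        (Rᗮ.starProjection).hasFDerivAt.comp y (hg y)
      have h2 : Rᗮ.starProjection ∘L H y = 0 := by
        ext1 v
        change Rᗮ.starProjection (H y v) = 0
        rw [Submodule.starProjection_apply_eq_zero_iff, Submodule.orthogonal_orthogonal,
          ← hrange y]
        exact ⟨v, rfl⟩
      rwa [h2] at h1
    exact is_const_of_fderiv_eq_zero (fun y => (hd y).differentiableAt) (fun y => (hd y).fderiv) x x₀
  suffices h : Rᗮ.starProjection (g x₀) = 0 by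
    rw [Submodule.starProjection_apply_eq_zero_iff, Submodule.orthogonal_orthogonal] at h
    exact h
  by_contra hne
  have hpos : 0 < ‖Rᗮ.starProjection (g x₀)‖ ^ 2 := by
    have := norm_pos_iff.mpr hne
    positivity
  set m := ⨅ x, ‖R.starProjection (g x)‖ with hm
  have hbdd : BddBelow (Set.range fun x => ‖R.starProjection (g x)‖) :=
    ⟨0, by rintro _ ⟨x, rfl⟩; exact norm_nonneg _⟩
  have ha : 0 < a := by
    by_contra! h
    have h1 := hν' x₀
    have h2 := mul_nonpos_of_nonpos_of_nonneg h (sq_nonneg ‖R.starProjection (g x₀)‖)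
    linarith
  have hm0 : 0 < m := by
    have h1 : √(‖Rᗮ.starProjection (g x₀)‖ ^ 2 / a) ≤ m := by
      refine le_ciInf fun x => ?_
      rw [← Real.sqrt_sq (norm_nonneg (R.starProjection (g x)))]
      refine Real.sqrt_le_sqrt ?_
      rw [div_le_iff₀ ha, ← hconst x, mul_comm]
      exact hν' x
    exact (Real.sqrt_pos.mpr (by positivity)).trans_le h1
  obtain ⟨β, hβ1, hβ2, hβ⟩ := exists_newton_decrease hg hs hL₀ hL hγ hgap hm0
  have hβ0 : 0 < β := by linarith
  -- A point with value below m/β is mapped by the Newton step to a value below the infimum m.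
  have hlt : m < m / β := by rw [lt_div_iff₀ hβ0]; nlinarith
  obtain ⟨x, hx⟩ := exists_lt_of_ciInf_lt hlt
  have h2m : m / β ≤ 2 * m := by rw [div_le_iff₀ hβ0]; nlinarith
  have h3 := hβ x
  simp only [hrange x] at h3
  obtain ⟨y, hy⟩ := h3 (hx.le.trans h2m)
  have h4 : m ≤ ‖R.starProjection (g y)‖ := ciInf_le hbdd y
  rw [lt_div_iff₀ hβ0] at hx
  linarith

end ConstantKernel

end NewtonMR

/-! ### The Newton step and the theorem. -/

namespace NewtonMR

variable {d : ℕ} {f : EuclideanSpace ℝ (Fin d) → ℝ}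

theorem TwiceDifferentiable.hasFDerivAt_gradient (hf : TwiceDifferentiable f)
    (x : EuclideanSpace ℝ (Fin d)) : HasFDerivAt (∇ f) (hess f x) x :=
  (hf.2 x).hasFDerivAt

theorem TwiceDifferentiable.isSymmetric_hess (hf : TwiceDifferentiable f)
    (x : EuclideanSpace ℝ (Fin d)) : (hess f x).toLinearMap.IsSymmetric := by
  let D := (InnerProductSpace.toDual ℝ (EuclideanSpace ℝ (Fin d))).toContinuousLinearEquiv
  have h1 : ∀ y, HasFDerivAt f (D (∇ f y)) y := fun y => (hf.1 y).hasGradientAt.hasFDerivAt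
  have h2 : HasFDerivAt (fun y => D (∇ f y)) (D.toContinuousLinearMap ∘L hess f x) x :=
    D.toContinuousLinearMap.hasFDerivAt.comp x (hf.hasFDerivAt_gradient x)
  intro v w
  have h3 := second_derivative_symmetric h1 h2 v w
  have h4 : ⟪hess f x v, w⟫_ℝ = ⟪hess f x w, v⟫_ℝ := h3
  exact h4.trans (real_inner_comm _ _)

/-- One step with a direction `p` of controlled length and small residual. -/
theorem norm_gradient_add_le (hf : TwiceDifferentiable f) {L ε θ β : ℝ}
    (hL : HessianLipschitz f L) {x p : EuclideanSpace ℝ (Fin d)}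
    {A : EuclideanSpace ℝ (Fin d) →L[ℝ] EuclideanSpace ℝ (Fin d)} (hε : 0 < ε) (hβ : 0 < β)
    (hD : ∀ y, ‖A y - hess f x y‖ ≤ ε * ‖y‖) (hr : ‖A p + ∇ f x‖ ≤ √θ * ‖∇ f x‖)
    (hp : ‖p‖ ≤ β⁻¹ * ‖∇ f x‖) :
    ‖∇ f (x + p)‖ ≤ L / (2 * β ^ 2) * ‖∇ f x‖ ^ 2 + (ε / β + √θ) * ‖∇ f x‖ := by
  have h1 := norm_sub_sub_le_of_lipschitz_deriv hf.hasFDerivAt_gradient hL.2 x p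
  have e : ∇ f (x + p) = (∇ f (x + p) - ∇ f x - hess f x p) + (A p + ∇ f x) -
      (A p - hess f x p) := by abel
  have h2 : ‖∇ f (x + p)‖ ≤ L / 2 * ‖p‖ ^ 2 + √θ * ‖∇ f x‖ + ε * ‖p‖ := by
    rw [e]
    exact (norm_sub_le _ _).trans (add_le_add ((norm_add_le _ _).trans (add_le_add h1 hr)) (hD p))
  have h3 := mul_le_mul_of_nonneg_left (pow_le_pow_left₀ (norm_nonneg p) hp 2)
    (div_nonneg hL.1 zero_le_two)
  have h4 := mul_le_mul_of_nonneg_left hp hε.le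
  have e1 : L / 2 * (β⁻¹ * ‖∇ f x‖) ^ 2 = L / (2 * β ^ 2) * ‖∇ f x‖ ^ 2 := by field_simp
  have e2 : ε * (β⁻¹ * ‖∇ f x‖) = ε / β * ‖∇ f x‖ := by field_simp
  rw [e1] at h3
  rw [e2] at h4
  linarith

theorem IsPerturbation.norm_sub_le {ε C : ℝ} {x : EuclideanSpace ℝ (Fin d)}
    {A : EuclideanSpace ℝ (Fin d) →L[ℝ] EuclideanSpace ℝ (Fin d)} (h : IsPerturbation f ε C x A)
    (y : EuclideanSpace ℝ (Fin d)) : ‖A y - hess f x y‖ ≤ ε * ‖y‖ := by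
  obtain ⟨⟨E, -, rfl, hE⟩, -⟩ := h
  rw [_root_.add_apply, add_sub_cancel_left]
  exact E.le_of_opNorm_le hE y

theorem IsPerturbation.isSymmetric (hf : TwiceDifferentiable f) {ε C : ℝ}
    {x : EuclideanSpace ℝ (Fin d)}
    {A : EuclideanSpace ℝ (Fin d) →L[ℝ] EuclideanSpace ℝ (Fin d)} (h : IsPerturbation f ε C x A) :
    A.toLinearMap.IsSymmetric := by
  obtain ⟨⟨E, hE, rfl, -⟩, -⟩ := h
  exact (hf.isSymmetric_hess x).add hE.isSymmetric

end NewtonMR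

theorem mainTheorem5 (d : ℕ) (f : EuclideanSpace ℝ (Fin d) → ℝ)
    (L γ ν ε C θ τ : ℝ)
    (hf : TwiceDifferentiable f) (hL : HessianLipschitz f L)
    (hγ : PseudoInverseRegular f γ) (hν : NullSpaceProperty f ν)
    (hε : 0 < ε) (hC : 1 ≤ C) (hθ : θ < 1) (hτ₀ : 0 < τ) (hτ₁ : τ < 1)
    (Ht : ℕ → EuclideanSpace ℝ (Fin d) →L[ℝ] EuclideanSpace ℝ (Fin d))
    (x : ℕ → EuclideanSpace ℝ (Fin d))
    (hHt : ∀ k, Active f τ x k → IsPerturbation f ε C (x k) (Ht k))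
    (hx : IsInexactNewtonMR f τ θ Ht x) :
    ∀ k, Active f τ x k →
      (((1 / 2 < ν ∧ ε < γ * (2 * ν - 1) / 4) ∨ (ν = 1 ∧ ε < γ * ν / 2)) →
        1 - nuTilde γ ν ε ≤ θ →
        ‖∇ f (x (k + 1))‖ ≤ L / (2 * gammaTilde γ ν ε C ^ 2) * ‖∇ f (x k)‖ ^ 2
          + (ε / gammaTilde γ ν ε C + √θ) * ‖∇ f (x k)‖) ∧
      (IsAcute f (x k) (Ht k) → ε < γ * ν / 2 →
        1 - nuTildeAcute γ ν ε ≤ θ →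
        ‖∇ f (x (k + 1))‖ ≤ L / (2 * gammaTildeAcute γ ε ^ 2) * ‖∇ f (x k)‖ ^ 2
          + (ε / gammaTildeAcute γ ε + √θ) * ‖∇ f (x k)‖) := by
  intro k hk
  obtain ⟨p, hp, hxp⟩ := hx k hk
  have hpert := hHt k hk
  have hsym := hpert.isSymmetric hf
  have hD := hpert.norm_sub_le
  have hr := hp.norm_residual_le hsym
  rw [hxp]
  constructor
  · intro _ hθ'
    -- From 1 − ν̃ ≤ θ < 1 one gets ν̃ > 0, and 2ν − 1 ≤ 1.
    have hεγ : 4 * ε ≤ γ := by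
      have h1 : 4 * ε / γ ≤ 1 := by
        unfold nuTilde at hθ'
        linarith [hν.2.1]
      rwa [div_le_one hγ.1] at h1
    have hγε : 0 < γ - ε := by linarith
    have hmem := grad_mem_range hf.hasFDerivAt_gradient hf.isSymmetric_hess hL.1 hL.2 hγ.1 hγ.2
      hν.2.2 (x k)
    have hpn := hp.norm_le hsym (hf.isSymmetric_hess _) hD (hγ.2 _) hε hεγ (by linarith) hpert.2
      hmem
    have h0 := hγ.1
    have hC0 : 0 ≤ C := by linarith
    have hβ : 0 < gammaTilde γ ν ε C := by unfold gammaTilde; positivity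
    refine norm_gradient_add_le hf hL hε hβ hD hr (hpn.trans ?_)
    refine mul_le_mul_of_nonneg_right ?_ (norm_nonneg _)
    rw [gammaTilde, inv_inv, mul_add]
    -- The bound on ‖p‖ has no term in √(1 − ν), because the gradient lies in the range; the one in
    -- γ̃⁻¹ is slack.
    have h1 : 0 ≤ C * (√(1 - ν) / ε) := by positivity
    have h2 : 2 * C / γ = C * (2 / γ) := by ring
    linarith
  · intro hacute hεν _
    have h1 : γ * ν ≤ γ := mul_le_of_le_one_right hγ.1.le hν.2.1
    have hεγ : ε < γ := by linarith [hγ.1]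
    have hβ : 0 < gammaTildeAcute γ ε := sub_pos.mpr hεγ
    refine norm_gradient_add_le hf hL hε hβ hD hr ?_
    rw [le_inv_mul_iff₀ hβ]
    exact hp.norm_le_of_rk_eq hsym hD (hγ.2 _) hεγ hacute
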